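/- Let $n\in\{2,3\}$, let $f_{A_1},\dots,f_{A_a}$ and $f_{B_1},\dots,f_{B_b}$ be real polynomials in $x\in\mathbb R^n$, and let $A=\{x: f_{A_j}(x)\ge 0\ \forall j\}$ (robot) and $B=\{x: f_{B_i}(x)\ge 0\ \forall i\}$ (free region), both expressed in the body frame. Fix $\theta\in\mathbb R$. For a control $u=(\hat\omega,\hat v)\in\mathbb R^3\times\mathbb R^3$ let $[\hat\omega]$ be the skew-symmetric matrix of $\hat\omega$, and put $R=I+\sin\theta\,[\hat\omega]+(1-\cos\theta)[\hat\omega]^2$, $p=\theta\hat v+(1-\cos\theta)[\hat\omega]\hat v+(\theta-\sin\theta)[\hat\omega]^2\hat v$, $T_u(x)=Rx+p$. Let $G$ be the set of all $u=(\hat\omega,\hat v)$ with $(\hat\omega^\top\hat\omega)(\hat\omega^\top\hat\omega-1)=0$, $v_{limit}^2-\hat v^\top\hat v\ge 0$ and, possibly, finitely many further polynomial inequalities in $u$; if $n=2$, the plane is the plane of the first two coordinates, all $u\in G$ are in addition required to be planar twists ($\hat\omega_1=\hat\omega_2=\hat v_3=0$), and $T_u$ is the planar motion obtained by restriction to this plane.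 Let $J$ be a real polynomial in $u$. A control $u$ is *safe* if $T_u(A)\subseteq B$. Let $f_{B_i}^{u}(x)=f_{B_i}(T_u(x))$, a polynomial in $x$. Let $J^*$ be the optimal value of $$\min_u J(u)\quad\text{s.t. } u\in G,\ f^u_{B_i}\ge 0 \text{ on } A\ \ (i=1,\dots,b),\tag{P}$$ and, for every $k$ with $2k\ge\deg f_{A_j}$ and $2k\ge \deg f_{B_i}$ for all $i,j$, let $J_k$ be the optimal value of the $k$-th order SOS relaxation $$\min_{u,\sigma} J(u)\quad\text{s.t. } u\in G,\ f_{B_i}^u=\sigma_{i,0}+\sum_{j=1}^a\sigma_{i,j}f_{A_j}\ \ (i=1,\dots,b),\tag{P$_k$}$$ where the $\sigma_{i,j}$ range over sums of squares of polynomials in $x$ with $\deg\sigma_{i,0}\le 2k$ and $\deg\sigma_{i,j}\le 2k-\deg f_{A_j}$ for $j\ge1$. (Optimal values are infima in $[-\infty,+\infty]$, equal to $+\infty$ for an infeasible problem.) Then, for every such $k$, the control of any minimizer of (P$_k$) is safe, and $J_k\ge J^*$; moreover $J_k$ is monotonically decreasing (non-increasing) in $k$. Suppose in addition that: 1. $B$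 is given by affine inequalities, i.e. $\deg f_{B_i}\le 1$ for all $i$; 2. there are an optimal control $(\hat\omega^*,\hat v^*)$ of (P) and a $\hat v^0\in\mathbb R^3$ with $(\hat\omega^*,\hat v^0)\in G$ and $f_{B_i}^{(\hat\omega^*,\hat v^0)}(x)>0$ for all $x\in A$ and all $i$; 3. $G$ is convex in $\hat v$, i.e. $\{\hat v:(\hat\omega,\hat v)\in G\}$ is convex for every $\hat\omega$; 4. the quadratic module $\mathrm{Qmod}[f_A]=\{\sigma_0+\sum_j\sigma_jf_{A_j}: \sigma_0,\dots,\sigma_a \text{ sums of squares}\}$ is archimedean, i.e. it contains some $\rho$ for which $\{x\in\mathbb R^n:\rho(x)\ge 0\}$ is bounded. Then $J_k\to J^*$ as $k\to\infty$. -/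

import Mathlib

/-- The cone `𝒫(K)` of real polynomials that are nonnegative on `K ⊆ ℝⁿ`. -/
def nonnegPolynomials {n : ℕ} (K : Set (Fin n → ℝ)) : Set (MvPolynomial (Fin n) ℝ) :=
  {p | ∀ x ∈ K, 0 ≤ MvPolynomial.eval x p}

/-- The basic closed semialgebraic set `{x ∈ ℝⁿ | f₁(x) ≥ 0, …, f_m(x) ≥ 0}`. -/
def basicSet {n m : ℕ} (f : Fin m → MvPolynomial (Fin n) ℝ) : Set (Fin n → ℝ) :=
  {x | ∀ j, 0 ≤ MvPolynomial.eval x (f j)}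

/-- The quadratic module `Qmod[f] = {σ₀ + σ₁ f₁ + ⋯ + σ_m f_m | σ₀, …, σ_m sums of squares}`. -/
def quadraticModule {n m : ℕ} (f : Fin m → MvPolynomial (Fin n) ℝ) :
    Set (MvPolynomial (Fin n) ℝ) :=
  {p | ∃ (σ₀ : MvPolynomial (Fin n) ℝ) (σ : Fin m → MvPolynomial (Fin n) ℝ),
    IsSumSq σ₀ ∧ (∀ j, IsSumSq (σ j)) ∧ p = σ₀ + ∑ j, σ j * f j}

/-- `Qmod[f]` is archimedean: some `ρ ∈ Qmod[f]` has a bounded set `{x ∈ ℝⁿ | ρ(x) ≥ 0}`. -/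
def IsArchimedeanQmod {n m : ℕ} (f : Fin m → MvPolynomial (Fin n) ℝ) : Prop :=
  ∃ ρ ∈ quadraticModule f, Bornology.IsBounded {x : Fin n → ℝ | 0 ≤ MvPolynomial.eval x ρ}

/-- The skew-symmetric matrix `[ω]`, so that `[ω] y = ω × y`. -/
def skewMatrix (ω : Fin 3 → ℝ) : Matrix (Fin 3) (Fin 3) ℝ :=
  !![0, -ω 2, ω 1; ω 2, 0, -ω 0; -ω 1, ω 0, 0]

/-- The rotation `R(ω, θ) = I + sin θ [ω] + (1 - cos θ) [ω]²`. -/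
noncomputable def rotationPart (θ : ℝ) (ω : Fin 3 → ℝ) : Matrix (Fin 3) (Fin 3) ℝ :=
  1 + Real.sin θ • skewMatrix ω + (1 - Real.cos θ) • (skewMatrix ω) ^ 2

/-- The translation `p(ω, v, θ) = θ v + (1 - cos θ) [ω] v + (θ - sin θ) [ω]² v`. -/
noncomputable def translationPart (θ : ℝ) (ω v : Fin 3 → ℝ) : Fin 3 → ℝ :=
  θ • v + (1 - Real.cos θ) • (skewMatrix ω).mulVec v
    + (θ - Real.sin θ) • ((skewMatrix ω) ^ 2).mulVec v

/-- A control `u = (ω, v) ∈ ℝ⁶`: the angular and the linear part of a body screw axis. -/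
abbrev Control : Type := (Fin 3 → ℝ) × (Fin 3 → ℝ)

/-- The value at a control of a polynomial in the six coordinates of `(ω, v)`. -/
noncomputable def evalControl (p : MvPolynomial (Fin 3 ⊕ Fin 3) ℝ) (u : Control) : ℝ :=
  MvPolynomial.eval (Sum.elim u.1 u.2) p

/-- The data of the safety-constrained control problem: the robot lives in `ℝⁿ` with `n = 2` or
`n = 3`, moves a fixed distance `θ` along the screw axis, and both the robot geometry (`fA`) and
the free region (`fB`) are given by polynomial inequalities in the body frame. The cost is a
polynomial in the control. Besides the standard constraints on the control (see `feasibleSet`),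
finitely many polynomial inequalities `g l (u) ≥ 0` may be imposed. -/
structure SafeControlProblem (n a b m : ℕ) where
  /-- The ambient space of the robot is the plane or the space. -/
  dim_eq : n = 2 ∨ n = 3
  /-- The distance travelled along the screw axis in one time step. -/
  θ : ℝ
  /-- The limit of the linear velocity. -/
  vLimit : ℝ
  /-- The polynomials of the robot geometry. -/
  fA : Fin a → MvPolynomial (Fin n) ℝ
  /-- The polynomials of the free region. -/
  fB : Fin b → MvPolynomial (Fin n) ℝ
  /-- Additional polynomial constraints on the control. -/
  g : Fin m → MvPolynomial (Fin 3 ⊕ Fin 3) ℝ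
  /-- The cost. -/
  cost : MvPolynomial (Fin 3 ⊕ Fin 3) ℝ

namespace SafeControlProblem

/-- The coordinates of `ℝⁿ` as the first `n` coordinates of `ℝ³`. -/
def coord {n a b m : ℕ} (D : SafeControlProblem n a b m) (i : Fin n) : Fin 3 :=
  Fin.castLE (by rcases D.dim_eq with h | h <;> omega) i

/-- The robot geometry `A` in the body frame. -/
def robot {n a b m : ℕ} (D : SafeControlProblem n a b m) : Set (Fin n → ℝ) := basicSet D.fA

/-- The free region `B` in the (old) body frame. -/
def freeRegion {n a b m : ℕ} (D : SafeControlProblem n a b m) : Set (Fin n → ℝ) := basicSet D.fB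

/-- The feasible set `G` of controls: `ω` is zero or a unit vector, `|v|² ≤ vLimit²`, the additional
polynomial constraints hold, and for a planar robot the twist is planar (rotation about the third
axis, translation along the first two). -/
def feasibleSet {n a b m : ℕ} (D : SafeControlProblem n a b m) : Set Control :=
  {u | (u.1 ⬝ᵥ u.1) * (u.1 ⬝ᵥ u.1 - 1) = 0 ∧ 0 ≤ D.vLimit ^ 2 - u.2 ⬝ᵥ u.2 ∧
    (∀ l, 0 ≤ evalControl (D.g l) u) ∧
    (n = 2 → u.1 0 = 0 ∧ u.1 1 = 0 ∧ u.2 2 = 0)}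

/-- The motion `x ↦ R x + p` of one time step under the control `u`; it sends the coordinates of a
point in the new body frame to its coordinates in the old body frame. For `n = 2` and a planar twist
only the first two coordinates are involved. -/
noncomputable def motion {n a b m : ℕ} (D : SafeControlProblem n a b m) (u : Control)
    (x : Fin n → ℝ) : Fin n → ℝ := fun i =>
  (∑ j, rotationPart D.θ u.1 (D.coord i) (D.coord j) * x j)
    + translationPart D.θ u.1 u.2 (D.coord i)

/-- A control is safe if the robot, moved by it, lies in the free region. -/
def IsSafe {n a b m : ℕ} (D : SafeControlProblem n a b m) (u : Control) : Prop :=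
  D.motion u '' D.robot ⊆ D.freeRegion

/-- The `i`-th polynomial of the free region expressed in the new body frame, that is, the
polynomial `f_{B_i}(R x + p)` in `x`. -/
noncomputable def movedRegion {n a b m : ℕ} (D : SafeControlProblem n a b m) (u : Control)
    (i : Fin b) : MvPolynomial (Fin n) ℝ :=
  MvPolynomial.bind₁ (fun i' : Fin n =>
    (∑ j, MvPolynomial.C (rotationPart D.θ u.1 (D.coord i') (D.coord j)) * MvPolynomial.X j)
      + MvPolynomial.C (translationPart D.θ u.1 u.2 (D.coord i'))) (D.fB i)

/-- Feasibility for the safety-constrained problem. -/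
def IsFeasible {n a b m : ℕ} (D : SafeControlProblem n a b m) (u : Control) : Prop :=
  (∀ i, D.movedRegion u i ∈ nonnegPolynomials D.robot) ∧ u ∈ D.feasibleSet

/-- `u` is an optimal control of the safety-constrained problem. -/
def IsOptimal {n a b m : ℕ} (D : SafeControlProblem n a b m) (u : Control) : Prop :=
  D.IsFeasible u ∧ ∀ u', D.IsFeasible u' → evalControl D.cost u ≤ evalControl D.cost u'

/-- The optimal value `J*` of the safety-constrained problem (`+∞` if it is infeasible). -/
noncomputable def optimalValue {n a b m : ℕ} (D : SafeControlProblem n a b m) : EReal :=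
  sInf {y | ∃ u, D.IsFeasible u ∧ y = (evalControl D.cost u : EReal)}

/-- The admissible relaxation orders: `2k` is at least the degree of every robot and region
polynomial (a change of frame does not change the degree). -/
def IsOrder {n a b m : ℕ} (D : SafeControlProblem n a b m) (k : ℕ) : Prop :=
  (∀ j, (D.fA j).totalDegree ≤ 2 * k) ∧ ∀ i, (D.fB i).totalDegree ≤ 2 * k

/-- Feasibility of a control `u` with multipliers `σ₀ i`, `σ i j` for the `k`-th order SOS
relaxation. -/
def IsRelaxFeasible {n a b m : ℕ} (D : SafeControlProblem n a b m) (k : ℕ) (u : Control)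
    (σ₀ : Fin b → MvPolynomial (Fin n) ℝ) (σ : Fin b → Fin a → MvPolynomial (Fin n) ℝ) : Prop :=
  (∀ i, D.movedRegion u i = σ₀ i + ∑ j, σ i j * D.fA j) ∧ u ∈ D.feasibleSet ∧
    (∀ i, IsSumSq (σ₀ i) ∧ (σ₀ i).totalDegree ≤ 2 * k) ∧
    ∀ i j, IsSumSq (σ i j) ∧ (σ i j).totalDegree + (D.fA j).totalDegree ≤ 2 * k

/-- `(u, σ₀, σ)` is a minimizer of the `k`-th order SOS relaxation. -/
def IsRelaxMinimizer {n a b m : ℕ} (D : SafeControlProblem n a b m) (k : ℕ) (u : Control)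
    (σ₀ : Fin b → MvPolynomial (Fin n) ℝ) (σ : Fin b → Fin a → MvPolynomial (Fin n) ℝ) : Prop :=
  D.IsRelaxFeasible k u σ₀ σ ∧
    ∀ u' σ₀' σ', D.IsRelaxFeasible k u' σ₀' σ' → evalControl D.cost u ≤ evalControl D.cost u'

/-- The optimal value `J_k` of the `k`-th order SOS relaxation (`+∞` if it is infeasible). -/
noncomputable def relaxValue {n a b m : ℕ} (D : SafeControlProblem n a b m) (k : ℕ) : EReal :=
  sInf {y | ∃ u σ₀ σ, D.IsRelaxFeasible k u σ₀ σ ∧ y = (evalControl D.cost u : EReal)}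

/-- There is an optimal control `(ω*, v*)`, and a linear velocity `v⁰` such that `(ω*, v⁰)` is
in `G` and keeps the robot strictly inside the free region. -/
def StrictInteriorAssumption {n a b m : ℕ} (D : SafeControlProblem n a b m) : Prop :=
  ∃ ωs vs : Fin 3 → ℝ, D.IsOptimal (ωs, vs) ∧
    ∃ v0 : Fin 3 → ℝ, (ωs, v0) ∈ D.feasibleSet ∧
      ∀ x ∈ D.robot, ∀ i, 0 < MvPolynomial.eval x (D.movedRegion (ωs, v0) i)

end SafeControlProblem

/-! A certificate for the relaxation shows that each $f_{B_i}^u$ is nonnegative on $A$, so its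
control is safe and $J_k\ge J^*$; it remains valid at every larger order, so $J_k$ is
non-increasing. For convergence, fix $\hat\omega^*$ and move $\hat v$ from the optimal $\hat v^*$
towards $\hat v^0$. The motion is affine in $\hat v$ and the $f_{B_i}$ are affine, so strictly after
the start of the segment each $f_{B_i}^u$ is a convex combination, with positive weight on the
strictly positive end, and is positive on $A$; convexity of $G$ keeps the control admissible.
Putinar's Positivstellensatz then gives certificates of some finite order, and letting the control
tend to the optimal one gives $\limsup J_k\le J^*$ (`tendsto_relaxValue`).

Putinar's theorem (`mem_quadraticModule_of_pos`) is derived from ordered algebra. Transfer: a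
homomorphism from $\mathbb R[x]$ to an ordered field with the intermediate value property can be
replaced by a real point with the same signs on finitely many polynomials. This follows by
eliminating one variable at a time: the order and signs of finitely many points can be copied
between two such fields once the signs of finitely many coefficient expressions agree
(`SignEliminable.of_finset`). Real closure: a proper preordering extends to an ordering, whose image
in an algebraically closed field extends to a maximal cone; the differences of that cone form an
ordered field with the intermediate value property (`IsPreordering.exists_ringHom`). With transfer
this yields `neg_one_mem_of_forall_exists_eval_neg`. Archimedean part: that Positivstellensatz turns
a bounded set $\{\rho\ge 0\}$ into a certificate for some $N-\sum x_i^2$, which bounds every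
polynomial modulo the quadratic module. A proper quadratic module with this property is nonnegative
at a real point (`exists_algHom`). Hence for $p>0$ on the set, adjoining $-p$ produces $-1$, that is
$\sigma p-1\in M$ with $\sigma$ a sum of squares, and `mem_of_isSumSq_mul_sub_one_mem` removes the
factor $\sigma$. -/

/-! ### One-variable polynomials over ordered fields with the intermediate value property. -/

open Polynomial in
/-- The intermediate value property for polynomials over an ordered field. It characterizes the
real closed fields among the ordered fields. -/
def PolynomialIVP (K : Type*) [Field K] [LinearOrder K] : Prop :=
  ∀ (f : K[X]) (a b : K), a < b → f.eval a < 0 → 0 < f.eval b → ∃ c, a < c ∧ c < b ∧ f.eval c = 0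

theorem Real.polynomialIVP : PolynomialIVP ℝ := by
  intro f a b hab ha hb
  obtain ⟨c, hc, h0⟩ := intermediate_value_Ioo hab.le f.continuousOn ⟨ha, hb⟩
  exact ⟨c, hc.1, hc.2, h0⟩

namespace PolynomialIVP

open Polynomial

variable {K : Type*} [Field K] [LinearOrder K] [IsStrictOrderedRing K]

theorem exists_root_of_mul_neg (h : PolynomialIVP K) {f : K[X]} {a b : K} (hab : a < b)
    (hf : f.eval a * f.eval b < 0) : ∃ c, a < c ∧ c < b ∧ f.eval c = 0 := by
  rcases mul_neg_iff.1 hf with ⟨ha, hb⟩ | ⟨ha, hb⟩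
  · obtain ⟨c, h1, h2, h3⟩ := h (-f) a b hab (by simpa using ha) (by simpa using hb)
    exact ⟨c, h1, h2, by simpa using h3⟩
  · exact h f a b hab ha hb

/-- Rolle's theorem for two consecutive roots. -/
theorem exists_derivative_eq_zero_aux (h : PolynomialIVP K) {f : K[X]} (hf : f ≠ 0) {a b : K}
    (hab : a < b) (ha : f.eval a = 0) (hb : f.eval b = 0)
    (hno : ∀ c, a < c → c < b → f.eval c ≠ 0) :
    ∃ c, a < c ∧ c < b ∧ (derivative f).eval c = 0 := by
  obtain ⟨f1, hf1, hd1⟩ := f.exists_eq_pow_rootMultiplicity_mul_and_not_dvd hf a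
  have hf10 : f1 ≠ 0 := by rintro rfl; simp at hd1
  have hpa : f1.eval a ≠ 0 := by rwa [dvd_iff_isRoot] at hd1
  obtain ⟨g, hg, hd2⟩ := f1.exists_eq_pow_rootMultiplicity_mul_and_not_dvd hf10 b
  have hgb : g.eval b ≠ 0 := by rwa [dvd_iff_isRoot] at hd2
  obtain ⟨m, hm⟩ : ∃ m, f.rootMultiplicity a = m + 1 :=
    Nat.exists_eq_succ_of_ne_zero ((rootMultiplicity_pos hf).2 ha).ne'
  have hf1b : f1.eval b = 0 := by
    rw [hf1] at hb
    simpa [sub_eq_zero, hab.ne'] using hb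
  obtain ⟨n, hn⟩ : ∃ n, f1.rootMultiplicity b = n + 1 :=
    Nat.exists_eq_succ_of_ne_zero ((rootMultiplicity_pos hf10).2 hf1b).ne'
  rw [hm] at hf1
  rw [hn] at hg
  have hga : g.eval a ≠ 0 := by
    rw [hg] at hpa
    exact fun h0 => hpa (by simp [h0])
  have hgab : 0 < g.eval a * g.eval b := by
    rcases lt_or_gt_of_ne (mul_ne_zero hga hgb) with hlt | hgt
    · obtain ⟨c, h1, h2, h3⟩ := h.exists_root_of_mul_neg hab hlt
      exact absurd (by rw [hf1, hg]; simp [h3]) (hno c h1 h2)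
    · exact hgt
  -- With $f=(X-a)^{m+1}(X-b)^{n+1}g$, the factor $w$ is what remains of $f'$ after removing
  -- $(X-a)^m(X-b)^n$. At $a$ and $b$ only one summand survives, with opposite signs of the linear
  -- factor, while $g(a)g(b)>0$; so $w$ changes sign.
  set w : K[X] := C ((m : K) + 1) * (X - C b) * g + C ((n : K) + 1) * (X - C a) * g
    + (X - C a) * (X - C b) * derivative g with hw
  have hder : derivative f = (X - C a) ^ m * (X - C b) ^ n * w := by
    rw [hf1, hg, hw]
    simp only [derivative_mul, derivative_pow, derivative_sub, derivative_X, derivative_C]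
    simp only [Nat.add_sub_cancel, map_add, map_one, map_natCast, Nat.cast_add, Nat.cast_one]
    ring
  have hwab : w.eval a * w.eval b < 0 := by
    have : w.eval a * w.eval b
        = -(((m : K) + 1) * ((n : K) + 1) * (b - a) ^ 2 * (g.eval a * g.eval b)) := by
      rw [hw]; simp; ring
    rw [this]
    have hba : 0 < b - a := sub_pos.2 hab
    have : (0 : K) < ((m : K) + 1) * ((n : K) + 1) * (b - a) ^ 2 * (g.eval a * g.eval b) := by
      positivity
    linarith
  obtain ⟨c, h1, h2, h3⟩ := h.exists_root_of_mul_neg hab hwab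
  exact ⟨c, h1, h2, by rw [hder]; simp [h3]⟩

theorem exists_derivative_eq_zero (h : PolynomialIVP K) {f : K[X]} {a b : K}
    (hab : a < b) (ha : f.eval a = 0) (hb : f.eval b = 0) :
    ∃ c, a < c ∧ c < b ∧ (derivative f).eval c = 0 := by
  by_cases hf : f = 0
  · obtain ⟨c, h1, h2⟩ := exists_between hab
    exact ⟨c, h1, h2, by simp [hf]⟩
  have hne : (f.roots.toFinset.filter (a < ·)).Nonempty := ⟨b, by simp [hf, hab, hb]⟩
  -- The first root after $a$ reduces the claim to consecutive roots.
  set b' := (f.roots.toFinset.filter (a < ·)).min' hne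
  have hb' : b' ∈ f.roots.toFinset.filter (a < ·) := Finset.min'_mem _ _
  have hbb : b' ≤ b := Finset.min'_le _ _ (by simp [hf, hab, hb])
  simp only [Finset.mem_filter, Multiset.mem_toFinset, mem_roots hf, IsRoot.def] at hb'
  obtain ⟨c, h1, h2, h3⟩ := h.exists_derivative_eq_zero_aux hf hb'.2 ha hb'.1 (fun c h1 h2 h3 =>
    absurd (Finset.min'_le _ c (by simp [hf, h1, h3])) (not_le.2 h2))
  exact ⟨c, h1, h2.trans_le hbb, h3⟩

/-- The mean value theorem for polynomials. -/
theorem exists_derivative_eq_slope (h : PolynomialIVP K) (f : K[X]) {a b : K} (hab : a < b) :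
    ∃ c, a < c ∧ c < b ∧ f.eval b - f.eval a = (derivative f).eval c * (b - a) := by
  have hba : b - a ≠ 0 := sub_ne_zero.2 hab.ne'
  obtain ⟨c, h1, h2, h3⟩ := h.exists_derivative_eq_zero
    (f := f - C (f.eval a) - C ((f.eval b - f.eval a) / (b - a)) * (X - C a)) hab
    (by simp) (by simp [hba])
  refine ⟨c, h1, h2, ?_⟩
  simp only [derivative_sub, derivative_C, derivative_mul, derivative_X, eval_sub, eval_C,
    zero_mul, mul_one, zero_add, sub_zero, sub_eq_zero] at h3
  rw [h3, div_mul_cancel₀ _ hba]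

theorem sign_eval_eq (h : PolynomialIVP K) {f : K[X]} {a b : K}
    (hno : ∀ c, min a b ≤ c → c ≤ max a b → f.eval c ≠ 0) :
    SignType.sign (f.eval a) = SignType.sign (f.eval b) := by
  wlog hab : a ≤ b generalizing a b
  · exact (this (by simpa only [min_comm, max_comm] using hno) (le_of_not_ge hab)).symm
  rcases hab.eq_or_lt with rfl | hab
  · rfl
  rw [min_eq_left hab.le, max_eq_right hab.le] at hno
  have ha := hno a le_rfl hab.le
  have hb := hno b hab.le le_rfl
  have : 0 < f.eval a * f.eval b := by
    rcases lt_or_gt_of_ne (mul_ne_zero ha hb) with hlt | hgt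
    · obtain ⟨c, h1, h2, h3⟩ := h.exists_root_of_mul_neg hab hlt
      exact absurd h3 (hno c h1.le h2.le)
    · exact hgt
  rcases mul_pos_iff.1 this with ⟨h1, h2⟩ | ⟨h1, h2⟩
  · rw [sign_pos h1, sign_pos h2]
  · rw [sign_neg h1, sign_neg h2]

end PolynomialIVP

namespace Polynomial

variable {K : Type*} [Field K] [LinearOrder K] [IsStrictOrderedRing K]

/-- Write $f=f_1X+c$. A uniform bound $f_1\ge\varepsilon>0$ lets $x\varepsilon$ outgrow $c$; mere
positivity of $f_1$ would not carry the induction. -/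
theorem exists_pos_lt_eval (f : K[X]) (hf : 0 < f.leadingCoeff) :
    ∃ N, ∃ ε > 0, ∀ x ≥ N, ε ≤ f.eval x := by
  induction hd : f.natDegree generalizing f with
  | zero =>
    rw [natDegree_eq_zero] at hd
    obtain ⟨c, rfl⟩ := hd
    exact ⟨0, c, by simpa using hf, fun x _ => by simp⟩
  | succ d ih =>
    have hl : f.divX.leadingCoeff = f.leadingCoeff := by
      rw [leadingCoeff, natDegree_divX_eq_natDegree_tsub_one, coeff_divX, leadingCoeff, hd]
      rfl
    obtain ⟨N, ε, hε, hN⟩ := ih f.divX (hl ▸ hf)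
      (by rw [natDegree_divX_eq_natDegree_tsub_one, hd]; rfl)
    refine ⟨max N (max 0 ((1 - f.coeff 0) / ε)), 1, one_pos, fun x hx => ?_⟩
    simp only [ge_iff_le, max_le_iff] at hx
    have h1 := hN x hx.1
    have h2 := (div_le_iff₀ hε).1 hx.2.2
    have h3 : f.eval x = f.divX.eval x * x + f.coeff 0 := by
      conv_lhs => rw [← divX_mul_X_add f]
      simp
    have h4 := mul_le_mul_of_nonneg_right h1 hx.2.1
    rw [h3]
    linarith [mul_comm x ε]

theorem exists_forall_ge_sign_eval_eq (f : K[X]) :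
    ∃ N, ∀ x ≥ N, SignType.sign (f.eval x) = SignType.sign f.leadingCoeff := by
  rcases lt_trichotomy f.leadingCoeff 0 with hf | hf | hf
  · obtain ⟨N, ε, hε, hN⟩ := (-f).exists_pos_lt_eval (by simpa using hf)
    refine ⟨N, fun x hx => ?_⟩
    have := hN x hx
    rw [eval_neg] at this
    rw [sign_neg hf, sign_neg (by linarith)]
  · rw [leadingCoeff_eq_zero] at hf
    exact ⟨0, by simp [hf]⟩
  · obtain ⟨N, ε, hε, hN⟩ := f.exists_pos_lt_eval hf
    exact ⟨N, fun x hx => by rw [sign_pos hf, sign_pos (hε.trans_le (hN x hx))]⟩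

/-- Polynomials are continuous in the order topology of any ordered field; no completeness is
involved. -/
theorem exists_lt_lt_eval_pos (f : K[X]) {a b : K} (hab : a < b) (hb : 0 < f.eval b) :
    ∃ c, a < c ∧ c < b ∧ 0 < f.eval c := by
  let _ : TopologicalSpace K := Preorder.topology K
  have : OrderTopology K := ⟨rfl⟩
  have h1 : ∀ᶠ x in nhdsWithin b (Set.Iio b), 0 < f.eval x :=
    nhdsWithin_le_nhds (f.continuous.continuousAt.eventually (lt_mem_nhds hb))
  have h2 : ∀ᶠ x in nhdsWithin b (Set.Iio b), x ∈ Set.Ioo a b := Ioo_mem_nhdsLT hab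
  obtain ⟨c, hc, h3⟩ := (h1.and h2).exists
  exact ⟨c, h3.1, h3.2, hc⟩

end Polynomial

/-! ### Copying one point of a gap with the sign of a monotone polynomial. -/

namespace PolynomialIVP

open Polynomial

section OneField

variable {K : Type*} [Field K] [LinearOrder K] [IsStrictOrderedRing K]

/-- A polynomial that increases on a gap and is positive at its upper end takes a positive value
in the gap. -/
theorem exists_mem_gap_eval_pos_of_derivative_pos (f : K[X]) (lo hi : Finset K)
    (hlt : ∀ x ∈ lo, ∀ y ∈ hi, x < y)
    (hder : ∀ y, (∀ x ∈ lo, x < y) → (∀ x ∈ hi, y < x) → 0 < (derivative f).eval y)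
    (hend : ∀ b ∈ hi, (∀ x ∈ hi, b ≤ x) → 0 < f.eval b) :
    ∃ y, (∀ x ∈ lo, x < y) ∧ (∀ x ∈ hi, y < x) ∧ 0 < f.eval y := by
  obtain ⟨y₀, hy1, hy2⟩ := Order.exists_between_finsets lo hi hlt
  rcases hi.eq_empty_or_nonempty with rfl | hne
  · obtain ⟨N, hN⟩ := f.exists_forall_ge_sign_eval_eq
    obtain ⟨N', hN'⟩ := (derivative f).exists_forall_ge_sign_eval_eq
    have hy : ∀ x ∈ lo, x < max y₀ (max N N') := fun x hx => (hy1 x hx).trans_le (le_max_left _ _)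
    refine ⟨max y₀ (max N N'), hy, by simp, ?_⟩
    have h1 := hN' (max y₀ (max N N')) ((le_max_right _ _).trans (le_max_right _ _))
    rw [sign_pos (hder _ hy (by simp)), eq_comm, sign_eq_one_iff] at h1
    have hd : f.natDegree ≠ 0 := fun h0 => by
      rw [derivative_of_natDegree_zero h0] at h1; simp at h1
    have h2 : 0 < f.leadingCoeff := by
      have := leadingCoeff_derivative f
      rw [this] at h1
      have hpos : (0 : K) < f.natDegree := by exact_mod_cast Nat.pos_of_ne_zero hd
      exact (pos_iff_pos_of_mul_pos h1).2 hpos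
    rw [← sign_eq_one_iff, hN _ ((le_max_left _ _).trans (le_max_right _ _)), sign_pos h2]
  · have hb := hi.min'_mem hne
    obtain ⟨y, h1, h2, h3⟩ := f.exists_lt_lt_eval_pos (hy2 _ hb)
      (hend _ hb fun x hx => hi.min'_le x hx)
    exact ⟨y, fun x hx => (hy1 x hx).trans h1, fun x hx => h2.trans_le (hi.min'_le x hx), h3⟩

/-- The reflection $x\mapsto -x$ exchanges the two ends of the gap and the sign of the derivative.
-/
theorem exists_mem_gap_eval_pos_of_derivative_neg (f : K[X]) (lo hi : Finset K)
    (hlt : ∀ x ∈ lo, ∀ y ∈ hi, x < y)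
    (hder : ∀ y, (∀ x ∈ lo, x < y) → (∀ x ∈ hi, y < x) → (derivative f).eval y < 0)
    (hend : ∀ a ∈ lo, (∀ x ∈ lo, x ≤ a) → 0 < f.eval a) :
    ∃ y, (∀ x ∈ lo, x < y) ∧ (∀ x ∈ hi, y < x) ∧ 0 < f.eval y := by
  obtain ⟨y, h1, h2, h3⟩ := exists_mem_gap_eval_pos_of_derivative_pos (f.comp (-X))
    (hi.image Neg.neg) (lo.image Neg.neg)
    (by
      simp only [Finset.forall_mem_image]
      exact fun x hx y hy => neg_lt_neg (hlt y hy x hx))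
    (by
      simp only [Finset.forall_mem_image]
      intro y h1 h2
      have := hder (-y) (fun x hx => lt_neg.1 (h2 hx)) (fun x hx => neg_lt.1 (h1 hx))
      simpa [derivative_comp] using this)
    (by
      simp only [Finset.forall_mem_image]
      intro b hb h
      simpa using hend b hb fun x hx => neg_le_neg_iff.1 (h hx))
  simp only [Finset.forall_mem_image] at h1 h2
  exact ⟨-y, fun x hx => lt_neg.1 (h2 hx), fun x hx => neg_lt.1 (h1 hx), by simpa using h3⟩

end OneField

section TwoFields

variable {K₁ K₂ : Type*} [Field K₁] [LinearOrder K₁] [IsStrictOrderedRing K₁]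
  [Field K₂] [LinearOrder K₂] [IsStrictOrderedRing K₂]

/-- If $p_1(t)<0$ any point of the gap will do. Otherwise $p_1$ is strictly monotone near $t$ up to
the ends of its gap, so at the end where it grows, if there is one, it is positive. This sign
carries over to $p_2$ at the image of that end, and $p_2$ stays positive slightly inside the gap. An
unbounded gap is handled by leading coefficients. -/
theorem exists_mem_gap_sign_le (h₁ : PolynomialIVP K₁) (p₁ : K₁[X]) (p₂ : K₂[X])
    (G : Finset K₁) (s : K₁ → K₂) (hs : StrictMonoOn s G) {t : K₁} (ht : t ∉ G)
    (hsign : ∀ g ∈ G, SignType.sign (p₁.eval g) = SignType.sign (p₂.eval (s g)))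
    (hder₁ : ∀ z, (derivative p₁).eval z = 0 → z ∈ G)
    (hder₂ : ∀ y, (∀ g ∈ G, g < t → s g < y) → (∀ g ∈ G, t < g → y < s g) →
      SignType.sign ((derivative p₂).eval y) = SignType.sign ((derivative p₁).eval t)) :
    ∃ y, (∀ g ∈ G, g < t → s g < y) ∧ (∀ g ∈ G, t < g → y < s g) ∧
      SignType.sign (p₁.eval t) ≤ SignType.sign (p₂.eval y) := by
  classical
  set lo := (G.filter (· < t)).image s with hlo
  set hi := (G.filter (t < ·)).image s with hhi
  have hlo' : ∀ y, (∀ x ∈ lo, x < y) ↔ ∀ g ∈ G, g < t → s g < y := by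
    intro y
    simp only [hlo, Finset.forall_mem_image, Finset.mem_filter, and_imp]
  have hhi' : ∀ y, (∀ x ∈ hi, y < x) ↔ ∀ g ∈ G, t < g → y < s g := by
    intro y
    simp only [hhi, Finset.forall_mem_image, Finset.mem_filter, and_imp]
  have hlt : ∀ x ∈ lo, ∀ y ∈ hi, x < y := by
    simp only [hlo, hhi, Finset.forall_mem_image, Finset.mem_filter]
    exact fun x hx y hy => hs hx.1 hy.1 (hx.2.trans hy.2)
  simp only [← hlo', ← hhi'] at hder₂ ⊢
  have key : ∀ y, 0 < p₂.eval y → SignType.sign (p₁.eval t) ≤ SignType.sign (p₂.eval y) := by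
    intro y hy
    rw [sign_pos hy]
    cases SignType.sign (p₁.eval t) <;> decide
  rcases lt_or_ge (p₁.eval t) 0 with hneg | hnn
  · obtain ⟨y, hy1, hy2⟩ := Order.exists_between_finsets lo hi hlt
    refine ⟨y, hy1, hy2, ?_⟩
    rw [sign_neg hneg]
    cases SignType.sign (p₂.eval y) <;> decide
  rcases lt_trichotomy ((derivative p₁).eval t) 0 with hd | hd | hd
  · have hend : ∀ a ∈ lo, (∀ x ∈ lo, x ≤ a) → 0 < p₂.eval a := by
      simp only [hlo, Finset.forall_mem_image, Finset.mem_filter]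
      intro a ha hmax
      have hmax' : ∀ g ∈ G, g < t → g ≤ a := fun g hg hgt =>
        not_lt.1 fun hlt => absurd (hmax ⟨hg, hgt⟩) (not_le.2 (hs ha.1 hg hlt))
      rw [← sign_eq_one_iff, ← hsign a ha.1, sign_eq_one_iff]
      obtain ⟨c, hc1, hc2, hc3⟩ := h₁.exists_derivative_eq_slope p₁ ha.2
      have hc : (derivative p₁).eval c < 0 := by
        rw [← sign_eq_neg_one_iff, ← sign_neg hd]
        refine h₁.sign_eval_eq fun z hz1 hz2 hz => ?_
        rw [min_eq_left hc2.le] at hz1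
        rw [max_eq_right hc2.le] at hz2
        have hzG := hder₁ z hz
        have hzt : z < t := lt_of_le_of_ne hz2 fun h => ht (h ▸ hzG)
        exact absurd (hmax' z hzG hzt) (not_le.2 (hc1.trans_le hz1))
      nlinarith [mul_pos_of_neg_of_neg hc (sub_neg.2 ha.2)]
    obtain ⟨y, h1, h2, h3⟩ := exists_mem_gap_eval_pos_of_derivative_neg p₂ lo hi hlt
      (fun y h1 h2 => by rw [← sign_eq_neg_one_iff, hder₂ y h1 h2, sign_neg hd]) hend
    exact ⟨y, h1, h2, key y h3⟩
  · exact absurd (hder₁ t hd) ht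
  · have hend : ∀ b ∈ hi, (∀ x ∈ hi, b ≤ x) → 0 < p₂.eval b := by
      simp only [hhi, Finset.forall_mem_image, Finset.mem_filter]
      intro b hb hmin
      have hmin' : ∀ g ∈ G, t < g → b ≤ g := fun g hg hgt =>
        not_lt.1 fun hlt => absurd (hmin ⟨hg, hgt⟩) (not_le.2 (hs hg hb.1 hlt))
      rw [← sign_eq_one_iff, ← hsign b hb.1, sign_eq_one_iff]
      obtain ⟨c, hc1, hc2, hc3⟩ := h₁.exists_derivative_eq_slope p₁ hb.2
      have hc : 0 < (derivative p₁).eval c := by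
        rw [← sign_eq_one_iff, ← sign_pos hd]
        refine h₁.sign_eval_eq fun z hz1 hz2 hz => ?_
        rw [min_eq_right hc1.le] at hz1
        rw [max_eq_left hc1.le] at hz2
        have hzG := hder₁ z hz
        have hzt : t < z := lt_of_le_of_ne hz1 fun h => ht (h ▸ hzG)
        exact absurd (hmin' z hzG hzt) (not_le.2 (hz2.trans_lt hc2))
      nlinarith [mul_pos hc (sub_pos.2 hb.2)]
    obtain ⟨y, h1, h2, h3⟩ := exists_mem_gap_eval_pos_of_derivative_pos p₂ lo hi hlt
      (fun y h1 h2 => by rw [← sign_eq_one_iff, hder₂ y h1 h2, sign_pos hd]) hend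
    exact ⟨y, h1, h2, key y h3⟩

/-- An order embedding of a finite set that preserves the signs of a polynomial and that contains
the zeros of the derivative can be extended by one point. -/
theorem exists_mem_gap_sign_eq (h₁ : PolynomialIVP K₁) (h₂ : PolynomialIVP K₂)
    (p₁ : K₁[X]) (p₂ : K₂[X])
    (G : Finset K₁) (s : K₁ → K₂) (hs : StrictMonoOn s G) {t : K₁} (ht : t ∉ G)
    (hsign : ∀ g ∈ G, SignType.sign (p₁.eval g) = SignType.sign (p₂.eval (s g)))
    (hder₁ : ∀ z, (derivative p₁).eval z = 0 → z ∈ G)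
    (hder₂ : ∀ y, (∀ g ∈ G, g < t → s g < y) → (∀ g ∈ G, t < g → y < s g) →
      SignType.sign ((derivative p₂).eval y) = SignType.sign ((derivative p₁).eval t)) :
    ∃ y, (∀ g ∈ G, g < t → s g < y) ∧ (∀ g ∈ G, t < g → y < s g) ∧
      SignType.sign (p₂.eval y) = SignType.sign (p₁.eval t) := by
  obtain ⟨u, hu1, hu2, hu⟩ := h₁.exists_mem_gap_sign_le p₁ p₂ G s hs ht hsign hder₁ hder₂
  obtain ⟨l, hl1, hl2, hl⟩ := h₁.exists_mem_gap_sign_le (-p₁) (-p₂) G s hs ht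
    (fun g hg => by simp [Left.sign_neg, hsign g hg]) (fun z hz => hder₁ z (by simpa using hz))
    (fun y h1 h2 => by simp [Left.sign_neg, hder₂ y h1 h2])
  rw [eval_neg, eval_neg, Left.sign_neg, Left.sign_neg] at hl
  by_cases hu' : SignType.sign (p₂.eval u) = SignType.sign (p₁.eval t)
  · exact ⟨u, hu1, hu2, hu'⟩
  by_cases hl' : SignType.sign (p₂.eval l) = SignType.sign (p₁.eval t)
  · exact ⟨l, hl1, hl2, hl'⟩
  -- Applying the one-sided result to $\pm p$ gives $u$ with sign at least, and $l$ with sign at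
  -- most, that of $p_1(t)$. Both can miss only if $p_1(t)=0$ and $p_2(l)<0<p_2(u)$; then a root
  -- between $l$ and $u$ lies in the gap and has the right sign.
  have hall : ∀ a b c : SignType, a ≤ b → -a ≤ -c → b ≠ a → c ≠ a → a = 0 ∧ b = 1 ∧ c = -1 := by
    decide
  obtain ⟨h0, hb, hc⟩ := hall _ _ _ hu hl hu' hl'
  rw [sign_eq_one_iff] at hb
  rw [sign_eq_neg_one_iff] at hc
  have hor : ∃ y, min l u < y ∧ y < max l u ∧ p₂.eval y = 0 := by
    rcases lt_trichotomy l u with h | h | h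
    · rw [min_eq_left h.le, max_eq_right h.le]
      exact h₂ _ _ _ h hc hb
    · rw [h] at hc; exact absurd hc hb.le.not_gt
    · rw [min_eq_right h.le, max_eq_left h.le]
      exact h₂.exists_root_of_mul_neg h (mul_neg_of_pos_of_neg hb hc)
  obtain ⟨y, hy1, hy2, hy⟩ := hor
  refine ⟨y, fun g hg hgt => (lt_min (hl1 g hg hgt) (hu1 g hg hgt)).trans hy1,
    fun g hg hgt => hy2.trans (max_lt (hl2 g hg hgt) (hu2 g hg hgt)), ?_⟩
  rw [h0, hy, sign_zero]

end TwoFields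

end PolynomialIVP

/-! ### Sign-preserving embeddings of finite sets. -/

section

open Polynomial

theorem map_eraseLead {A B : Type*} [CommRing A] [CommRing B] {φ : A →+* B} {q : A[X]} (h : φ q.leadingCoeff = 0) :
    q.eraseLead.map φ = q.map φ := by
  rw [← self_sub_monomial_natDegree_leadingCoeff, Polynomial.map_sub, map_monomial, h,
    monomial_zero_right, sub_zero]

section SignEmbedding

variable {A : Type*} [CommRing A] {K₁ K₂ : Type*} [Field K₁] [LinearOrder K₁]
  [Field K₂] [LinearOrder K₂]

/-- Every finite subset of `K₁` can be mapped to `K₂` by a strictly monotone map that preserves the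
signs of the polynomials in `Q`. -/
def SignEmbedding (Q : Finset A[X]) (φ₁ : A →+* K₁) (φ₂ : A →+* K₂) : Prop :=
  ∀ F : Finset K₁, ∃ s : K₁ → K₂, StrictMonoOn s F ∧ ∀ q ∈ Q, ∀ t ∈ F,
    SignType.sign ((q.map φ₁).eval t) = SignType.sign ((q.map φ₂).eval (s t))

theorem SignEmbedding.mono {Q Q' : Finset A[X]} {φ₁ : A →+* K₁} {φ₂ : A →+* K₂} (h : Q ⊆ Q')
    (hQ : SignEmbedding Q' φ₁ φ₂) : SignEmbedding Q φ₁ φ₂ := fun F =>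
  let ⟨s, hs, hq⟩ := hQ F
  ⟨s, hs, fun q hqQ => hq q (h hqQ)⟩

theorem map_eq_zero_iff_of_sign_coeff_eq {φ₁ : A →+* K₁} {φ₂ : A →+* K₂} {q : A[X]}
    (h : ∀ i, SignType.sign (φ₁ (q.coeff i)) = SignType.sign (φ₂ (q.coeff i))) :
    q.map φ₁ = 0 ↔ q.map φ₂ = 0 := by
  simp only [Polynomial.ext_iff, coeff_map, coeff_zero]
  refine forall_congr' fun i => ?_
  rw [← sign_eq_zero_iff, h i, sign_eq_zero_iff]

theorem mem_biUnion_roots {φ : A →+* K₁} {Q : Finset A[X]} {z : K₁} :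
    z ∈ Q.biUnion (fun q => (q.map φ).roots.toFinset) ↔
      ∃ q ∈ Q, q.map φ ≠ 0 ∧ (q.map φ).eval z = 0 := by
  simp

/-- Dropping leading terms that vanish under `φ₁` and `φ₂`. -/
theorem exists_iterate_eraseLead {φ₁ : A →+* K₁} {φ₂ : A →+* K₂} (q : A[X])
    (h : ∀ i, SignType.sign (φ₁ (q.coeff i)) = SignType.sign (φ₂ (q.coeff i)))
    (hq : q.map φ₁ ≠ 0) :
    ∃ i ≤ q.natDegree, (eraseLead^[i] q).natDegree ≤ q.natDegree ∧
      (eraseLead^[i] q).map φ₁ = q.map φ₁ ∧ (eraseLead^[i] q).map φ₂ = q.map φ₂ ∧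
      φ₁ (eraseLead^[i] q).leadingCoeff ≠ 0 ∧ φ₂ (eraseLead^[i] q).leadingCoeff ≠ 0 := by
  induction hd : q.natDegree using Nat.strong_induction_on generalizing q with
  | _ d ih =>
  have h2 : φ₁ q.leadingCoeff = 0 ↔ φ₂ q.leadingCoeff = 0 := by
    rw [← sign_eq_zero_iff, leadingCoeff, h, sign_eq_zero_iff]
  by_cases hl : φ₁ q.leadingCoeff = 0
  · have hm₁ := map_eraseLead hl
    have hm₂ := map_eraseLead (h2.1 hl)
    have hlt : q.eraseLead.natDegree < d := by
      rcases eraseLead_natDegree_lt_or_eraseLead_eq_zero q with h' | h'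
      · exact hd ▸ h'
      · rw [← hm₁, h'] at hq
        simp at hq
    obtain ⟨i, hi, hdeg, h3, h4, h5⟩ := ih _ hlt q.eraseLead (fun i => by
      rw [eraseLead_coeff]
      split_ifs
      · simp
      · exact h i) (hm₁ ▸ hq) rfl
    exact ⟨i + 1, by omega, by simpa using hdeg.trans hlt.le, by simpa using h3.trans hm₁,
      by simpa using h4.trans hm₂, by simpa using h5⟩
  · exact ⟨0, Nat.zero_le _, by simp [hd], rfl, rfl, hl, fun h0 => hl (h2.2 h0)⟩

/-- Sign preservation sends roots to roots in both directions, and both maps are injective on them.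
Counting then shows that the embedding hits every root over `K₂`, so no unexpected zeros lie between
the images. -/
theorem SignEmbedding.exists_image_roots_eq {Q Q' : Finset A[X]} {φ₁ : A →+* K₁} {φ₂ : A →+* K₂}
    (hQ : Q' ⊆ Q) (e₁₂ : SignEmbedding Q φ₁ φ₂) (e₂₁ : SignEmbedding Q φ₂ φ₁)
    (hcoeff : ∀ q ∈ Q', ∀ i, SignType.sign (φ₁ (q.coeff i)) = SignType.sign (φ₂ (q.coeff i)))
    (F : Finset K₁) :
    ∃ s : K₁ → K₂, StrictMonoOn s (F ∪ Q'.biUnion fun q => (q.map φ₁).roots.toFinset : Finset K₁) ∧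
      (∀ q ∈ Q, ∀ t ∈ F ∪ Q'.biUnion fun q => (q.map φ₁).roots.toFinset,
        SignType.sign ((q.map φ₁).eval t) = SignType.sign ((q.map φ₂).eval (s t))) ∧
      (Q'.biUnion fun q => (q.map φ₁).roots.toFinset).image s =
        Q'.biUnion fun q => (q.map φ₂).roots.toFinset := by
  set Z₁ := Q'.biUnion fun q => (q.map φ₁).roots.toFinset with hZ₁
  set Z₂ := Q'.biUnion fun q => (q.map φ₂).roots.toFinset with hZ₂
  obtain ⟨s, hs, hsign⟩ := e₁₂ (F ∪ Z₁)
  obtain ⟨r, hr, hrsign⟩ := e₂₁ Z₂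
  refine ⟨s, hs, hsign, ?_⟩
  have hsub : Z₁.image s ⊆ Z₂ := by
    intro y hy
    obtain ⟨z, hz, rfl⟩ := Finset.mem_image.1 hy
    obtain ⟨q, hq, hq0, hqz⟩ := mem_biUnion_roots.1 hz
    refine mem_biUnion_roots.2 ⟨q, hq, fun h => hq0 ?_, ?_⟩
    · exact (map_eq_zero_iff_of_sign_coeff_eq (hcoeff q hq)).2 h
    · rw [← sign_eq_zero_iff, ← hsign q (hQ hq) z (Finset.mem_union_right _ hz), hqz, sign_zero]
  have hsub' : Z₂.image r ⊆ Z₁ := by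
    intro y hy
    obtain ⟨z, hz, rfl⟩ := Finset.mem_image.1 hy
    obtain ⟨q, hq, hq0, hqz⟩ := mem_biUnion_roots.1 hz
    refine mem_biUnion_roots.2 ⟨q, hq, fun h => hq0 ?_, ?_⟩
    · exact (map_eq_zero_iff_of_sign_coeff_eq (hcoeff q hq)).1 h
    · rw [← sign_eq_zero_iff, ← hrsign q (hQ hq) z hz, hqz, sign_zero]
  refine Finset.eq_of_subset_of_card_le hsub ?_
  rw [Finset.card_image_of_injOn (hs.injOn.mono (by simp))]
  exact (Finset.card_image_of_injOn hr.injOn).symm.trans_le (Finset.card_le_card hsub')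

/-- A multiple of the remainder of one step of the division of `p` by `q`. -/
noncomputable def divisionStep (q p : A[X]) : A[X] := C q.leadingCoeff * cancelLeads q p

theorem natDegree_divisionStep_lt {q p : A[X]} (h : q.natDegree ≤ p.natDegree)
    (hp : 0 < p.natDegree) : (divisionStep q p).natDegree < p.natDegree :=
  (natDegree_C_mul_le _ _).trans_lt
    (natDegree_cancelLeads_lt_of_natDegree_le_natDegree h hp)

variable [IsStrictOrderedRing K₁] [IsStrictOrderedRing K₂]

/-- At a zero of $q$ the step equals $\varphi(\mathrm{lc}(q))^2\,p$. The second factor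
$\mathrm{lc}(q)$ makes the multiplier a square, so its sign need not be known and no division in `A`
is needed. -/
theorem sign_eval_divisionStep (φ : A →+* K₁) {q p : A[X]} (h : q.natDegree ≤ p.natDegree)
    (hl : φ q.leadingCoeff ≠ 0) {z : K₁} (hz : (q.map φ).eval z = 0) :
    SignType.sign (((divisionStep q p).map φ).eval z) = SignType.sign ((p.map φ).eval z) := by
  have : ((divisionStep q p).map φ).eval z = φ q.leadingCoeff ^ 2 * (p.map φ).eval z := by
    simp only [divisionStep, cancelLeads, Polynomial.map_mul, Polynomial.map_sub, map_C,
      Polynomial.map_pow, map_X, eval_mul, eval_sub, eval_C, eval_pow, eval_X, hz,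
      Nat.sub_eq_zero_of_le h]
    ring
  rw [this, sign_mul, sign_pos (by positivity), one_mul]

-- The zeros of `Q₁` include those of $p'$, so they cut the line into gaps on which $p$ is monotone.
-- The signs of $p$ at these zeros are signs of remainders, which lie in `Q₀`. This is enough to
-- place the points of `F` gap by gap.
open Classical in
theorem SignEmbedding.insert {Q₁ Q₀ : Finset A[X]} {p : A[X]} {φ₁ : A →+* K₁} {φ₂ : A →+* K₂}
    (h₁ : PolynomialIVP K₁) (h₂ : PolynomialIVP K₂) (hQ : Q₁ ⊆ Q₀) (hder : derivative p ∈ Q₁)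
    (hp : 0 < p.natDegree) (hl : φ₁ p.leadingCoeff ≠ 0) (hdeg : ∀ q ∈ Q₁, q.natDegree ≤ p.natDegree)
    (hcoeff : ∀ q ∈ Q₁, ∀ i, SignType.sign (φ₁ (q.coeff i)) = SignType.sign (φ₂ (q.coeff i)))
    (hred : ∀ q ∈ Q₁, ∀ i ≤ q.natDegree, divisionStep (eraseLead^[i] q) p ∈ Q₀)
    (e₁₂ : SignEmbedding Q₀ φ₁ φ₂) (e₂₁ : SignEmbedding Q₀ φ₂ φ₁) :
    SignEmbedding (insert p Q₁) φ₁ φ₂ := by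
  intro F
  obtain ⟨s₀, hs₀, hsign₀, himage⟩ := e₁₂.exists_image_roots_eq hQ e₂₁ hcoeff F
  set Z₁ := Q₁.biUnion fun q => (q.map φ₁).roots.toFinset with hZ₁
  set Z₂ := Q₁.biUnion fun q => (q.map φ₂).roots.toFinset with hZ₂
  -- `Z₁` collects the roots of nonzero polynomials only, so this is needed for the zeros of $p'$ to
  -- belong to it.
  have hdne : derivative (p.map φ₁) ≠ 0 := by
    intro h0
    have hn : (p.map φ₁).natDegree = p.natDegree := natDegree_map_of_leadingCoeff_ne_zero _ hl
    have := derivative_eq_zero.1 h0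
    omega
  have hsignp : ∀ z ∈ Z₁, SignType.sign ((p.map φ₁).eval z)
      = SignType.sign ((p.map φ₂).eval (s₀ z)) := by
    intro z hz
    obtain ⟨q, hq, hq0, hqz⟩ := mem_biUnion_roots.1 hz
    obtain ⟨i, hi, hdi, hi₁, hi₂, hl₁, hl₂⟩ := exists_iterate_eraseLead q (hcoeff q hq) hq0
    rw [← sign_eval_divisionStep φ₁ (hdi.trans (hdeg q hq)) hl₁ (hi₁ ▸ hqz),
      ← sign_eval_divisionStep φ₂ (q := eraseLead^[i] q) (hdi.trans (hdeg q hq)) hl₂ ?_]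
    · exact hsign₀ _ (hred q hq i hi) z (Finset.mem_union_right _ hz)
    · rw [hi₂, ← sign_eq_zero_iff, ← hsign₀ q (hQ hq) z (Finset.mem_union_right _ hz), hqz,
        sign_zero]
  -- All roots of `Q₁` over `K₂` are images of `Z₁`, so none lies between `y` and `s₀ t`: every
  -- point of the gap carries the signs of `t` for `Q₁`.
  have hside : ∀ t ∈ F, t ∉ Z₁ → ∀ y, (∀ z ∈ Z₁, z < t → s₀ z < y) → (∀ z ∈ Z₁, t < z → y < s₀ z) →
      ∀ q ∈ Q₁, SignType.sign ((q.map φ₂).eval y) = SignType.sign ((q.map φ₁).eval t) := by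
    intro t ht htZ y hy1 hy2 q hq
    rw [hsign₀ q (hQ hq) t (Finset.mem_union_left _ ht)]
    by_cases hq0 : q.map φ₂ = 0
    · simp [hq0]
    refine h₂.sign_eval_eq fun c hc1 hc2 hc => ?_
    have hcZ : c ∈ Z₂ := mem_biUnion_roots.2 ⟨q, hq, hq0, hc⟩
    rw [← himage] at hcZ
    obtain ⟨z, hz, rfl⟩ := Finset.mem_image.1 hcZ
    have htm : t ∈ (↑(F ∪ Z₁) : Set K₁) := by simp [ht]
    have hzm : z ∈ (↑(F ∪ Z₁) : Set K₁) := by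
      exact Finset.mem_coe.2 (Finset.mem_union_right _ hz)
    rcases lt_trichotomy z t with h | h | h
    · exact absurd hc1 (not_le.2 (lt_min (hy1 z hz h) (hs₀ hzm htm h)))
    · exact htZ (h ▸ hz)
    · exact absurd hc2 (not_le.2 (max_lt (hy2 z hz h) (hs₀ htm hzm h)))
  -- Only `Z₁` keeps its images under `s₀`. The points of `F` outside `Z₁` are placed anew, one at a
  -- time, because `s₀` need not respect the sign of $p$ there.
  have key : ∀ F' ⊆ F, ∃ s : K₁ → K₂, (∀ z ∈ Z₁, s z = s₀ z) ∧
      StrictMonoOn s (Z₁ ∪ F' : Finset K₁) ∧ ∀ q ∈ Insert.insert p Q₁, ∀ t ∈ Z₁ ∪ F',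
        SignType.sign ((q.map φ₁).eval t) = SignType.sign ((q.map φ₂).eval (s t)) := by
    intro F'
    induction F' using Finset.induction_on with
    | empty =>
      intro _
      refine ⟨s₀, fun _ _ => rfl, hs₀.mono (by simp), fun q hq t ht => ?_⟩
      rw [Finset.union_empty] at ht
      rcases Finset.mem_insert.1 hq with rfl | hq
      · exact hsignp t ht
      · exact hsign₀ q (hQ hq) t (Finset.mem_union_right _ ht)
    | insert t F' htF' ih =>
      intro hF
      obtain ⟨s, hsZ, hs, hsign⟩ := ih fun x hx => hF (Finset.mem_insert_of_mem hx)
      have htF : t ∈ F := hF (Finset.mem_insert_self _ _)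
      by_cases htG : t ∈ Z₁ ∪ F'
      · rw [Finset.union_insert, Finset.insert_eq_of_mem htG]
        exact ⟨s, hsZ, hs, hsign⟩
      have htZ : t ∉ Z₁ := fun h => htG (Finset.mem_union_left _ h)
      have hside' : ∀ y, (∀ g ∈ Z₁ ∪ F', g < t → s g < y) → (∀ g ∈ Z₁ ∪ F', t < g → y < s g) →
          ∀ q ∈ Q₁, SignType.sign ((q.map φ₂).eval y) = SignType.sign ((q.map φ₁).eval t) :=
        fun y hy1 hy2 => hside t htF htZ y
          (fun z hz => hsZ z hz ▸ hy1 z (Finset.mem_union_left _ hz))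
          (fun z hz => hsZ z hz ▸ hy2 z (Finset.mem_union_left _ hz))
      obtain ⟨y, hy1, hy2, hy⟩ := h₁.exists_mem_gap_sign_eq h₂ (p.map φ₁) (p.map φ₂) (Z₁ ∪ F') s hs
        htG (hsign p (Finset.mem_insert_self _ _))
        (fun z hz => Finset.mem_union_left _ (mem_biUnion_roots.2
          ⟨derivative p, hder, by rwa [← derivative_map], by rwa [← derivative_map]⟩))
        (fun y hy1 hy2 => by
          rw [derivative_map, derivative_map]
          exact hside' y hy1 hy2 _ hder)
      have hne : ∀ g ∈ Z₁ ∪ F', g ≠ t := fun g hg h => htG (h ▸ hg)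
      refine ⟨Function.update s t y, fun z hz => ?_, ?_, fun q hq u hu => ?_⟩
      · rw [Function.update_of_ne (fun h : z = t => htZ (h ▸ hz)), hsZ z hz]
      · rw [Finset.union_insert]
        intro u hu v hv huv
        rw [Finset.mem_coe, Finset.mem_insert] at hu hv
        rcases hu with rfl | hu <;> rcases hv with rfl | hv
        · exact absurd huv (lt_irrefl _)
        · rw [Function.update_self, Function.update_of_ne (hne v hv)]
          exact hy2 v hv huv
        · rw [Function.update_self, Function.update_of_ne (hne u hu)]
          exact hy1 u hu huv
        · rw [Function.update_of_ne (hne u hu), Function.update_of_ne (hne v hv)]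
          exact hs hu hv huv
      · rw [Finset.union_insert] at hu
        rcases Finset.mem_insert.1 hu with rfl | hu
        · rw [Function.update_self]
          rcases Finset.mem_insert.1 hq with rfl | hq
          · exact hy.symm
          · exact (hside' y hy1 hy2 q hq).symm
        · rw [Function.update_of_ne (hne u hu)]
          exact hsign q hq u hu
  obtain ⟨s, -, hs, hsign⟩ := key F subset_rfl
  exact ⟨s, hs.mono (by simp), fun q hq t ht => hsign q hq t (Finset.mem_union_right _ ht)⟩

end SignEmbedding

end

/-! ### Elimination of a variable and the transfer principle. -/

section

open Polynomial

/-- There are finitely many elements of `A` whose signs determine which sign conditions on the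
polynomials in `Q` are satisfiable in an ordered field with the intermediate value property. -/
def SignEliminable {A : Type} [CommRing A] (Q : Finset A[X]) : Prop :=
  ∃ S : Finset A, ∀ (K₁ K₂ : Type) [Field K₁] [LinearOrder K₁] [IsStrictOrderedRing K₁]
    [Field K₂] [LinearOrder K₂] [IsStrictOrderedRing K₂] (φ₁ : A →+* K₁) (φ₂ : A →+* K₂),
    PolynomialIVP K₁ → PolynomialIVP K₂ →
    (∀ a ∈ S, SignType.sign (φ₁ a) = SignType.sign (φ₂ a)) → SignEmbedding Q φ₁ φ₂

namespace SignEliminable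

variable {A : Type} [CommRing A]

theorem mono {Q Q' : Finset A[X]} (h : Q ⊆ Q') (hQ : SignEliminable Q') : SignEliminable Q :=
  let ⟨S, hS⟩ := hQ
  ⟨S, fun K₁ K₂ _ _ _ _ _ _ φ₁ φ₂ h₁ h₂ hsign => (hS K₁ K₂ φ₁ φ₂ h₁ h₂ hsign).mono h⟩

theorem _root_.exists_strictMonoOn_finset {α β : Type*} [LinearOrder α] [LinearOrder β]
    [Nonempty β] [NoMaxOrder β] (F : Finset α) : ∃ s : α → β, StrictMonoOn s F := by
  obtain ⟨f, hf⟩ := Nat.exists_strictMono β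
  refine ⟨fun a => f (F.filter (· < a)).card, fun a ha b _ hab => hf (Finset.card_lt_card ?_)⟩
  refine Finset.ssubset_iff_subset_ne.2 ⟨fun x hx => ?_, fun h => ?_⟩
  · simp only [Finset.mem_filter] at hx ⊢
    exact ⟨hx.1, hx.2.trans hab⟩
  · have : a ∈ F.filter (· < b) := Finset.mem_filter.2 ⟨ha, hab⟩
    rw [← h] at this
    exact absurd (Finset.mem_filter.1 this).2 (lt_irrefl _)

theorem empty : SignEliminable (∅ : Finset A[X]) :=
  ⟨∅, fun K₁ K₂ _ _ _ _ _ _ _ _ _ _ _ F =>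
    let ⟨s, hs⟩ := exists_strictMonoOn_finset F
    ⟨s, hs, by simp⟩⟩

open Classical in
theorem insert_of_natDegree_eq_zero {Q : Finset A[X]} {p : A[X]} (hp : p.natDegree = 0)
    (hQ : SignEliminable Q) : SignEliminable (insert p Q) := by
  obtain ⟨S, hS⟩ := hQ
  obtain ⟨a, rfl⟩ := natDegree_eq_zero.1 hp
  refine ⟨insert a S, fun K₁ K₂ _ _ _ _ _ _ φ₁ φ₂ h₁ h₂ hsign F => ?_⟩
  obtain ⟨s, hs, hq⟩ := hS K₁ K₂ φ₁ φ₂ h₁ h₂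
    (fun a ha => hsign a (Finset.mem_insert_of_mem ha)) F
  refine ⟨s, hs, fun q hq' t ht => ?_⟩
  rcases Finset.mem_insert.1 hq' with rfl | hq'
  · simpa using hsign a (Finset.mem_insert_self _ _)
  · exact hq q hq' t ht

-- The added elements decide whether the leading coefficient of $p$ vanishes and make the
-- coefficients of `Q₁` agree in sign. If it vanishes, $p$ acts as `p.eraseLead`, which is in `Q₀`;
-- otherwise `SignEmbedding.insert` applies.
open Classical in
theorem insert_of_natDegree_pos {Q₁ Q₀ : Finset A[X]} {p : A[X]} (hQ : Q₁ ⊆ Q₀)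
    (hder : derivative p ∈ Q₁) (hp : 0 < p.natDegree)
    (hdeg : ∀ q ∈ Q₁, q.natDegree ≤ p.natDegree)
    (hred : ∀ q ∈ Q₁, ∀ i ≤ q.natDegree, divisionStep (eraseLead^[i] q) p ∈ Q₀)
    (hlead : p.eraseLead ∈ Q₀) (h₀ : SignEliminable Q₀) : SignEliminable (insert p Q₁) := by
  obtain ⟨S, hS⟩ := h₀
  refine ⟨insert p.leadingCoeff (S ∪ Q₁.biUnion fun q => q.coeffs),
    fun K₁ K₂ _ _ _ _ _ _ φ₁ φ₂ h₁ h₂ hsign => ?_⟩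
  simp only [Finset.mem_insert, Finset.mem_union, Finset.mem_biUnion] at hsign
  have hl := hsign _ (Or.inl rfl)
  have hSsign := fun a ha => hsign a (Or.inr (Or.inl ha))
  have e₁₂ := hS K₁ K₂ φ₁ φ₂ h₁ h₂ hSsign
  by_cases hl0 : φ₁ p.leadingCoeff = 0
  · have hl0' : φ₂ p.leadingCoeff = 0 := by rw [← sign_eq_zero_iff, ← hl, hl0, sign_zero]
    intro F
    obtain ⟨s, hs, hq⟩ := e₁₂ F
    refine ⟨s, hs, fun q hq' t ht => ?_⟩
    rcases Finset.mem_insert.1 hq' with rfl | hq'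
    · rw [← map_eraseLead hl0, ← map_eraseLead hl0']
      exact hq _ hlead t ht
    · exact hq q (hQ hq') t ht
  · refine SignEmbedding.insert h₁ h₂ hQ hder hp hl0 hdeg (fun q hq i => ?_) hred e₁₂
      (hS K₂ K₁ φ₂ φ₁ h₂ h₁ fun a ha => (hSsign a ha).symm)
    by_cases hi : q.coeff i = 0
    · simp [hi]
    · exact hsign _ (Or.inr (Or.inr ⟨q, hq, coeff_mem_coeffs hi⟩))

-- Termination of the elimination: a top-degree $p\in L$ is traded for its derivative, its tail and
-- its remainders, all of smaller degree. `L` loses an element whatever happens to the size of `Q`;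
-- once `L` is empty the degree bound drops.
open Classical in
theorem union_of_natDegree_le (d : ℕ) (L Q : Finset A[X]) (hL : ∀ p ∈ L, p.natDegree ≤ d)
    (hQ : ∀ q ∈ Q, q.natDegree < d) : SignEliminable (L ∪ Q) := by
  induction d generalizing L Q with
  | zero =>
    have : Q = ∅ := Finset.eq_empty_of_forall_notMem fun q hq => absurd (hQ q hq) (by omega)
    subst this
    rw [Finset.union_empty]
    induction L using Finset.induction_on with
    | empty => exact empty
    | insert p L _ ih =>
      exact insert_of_natDegree_eq_zero (Nat.le_zero.1 (hL p (Finset.mem_insert_self _ _)))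
        (ih fun q hq => hL q (Finset.mem_insert_of_mem hq))
  | succ d ihd =>
    induction L using Finset.induction_on generalizing Q with
    | empty => simpa using ihd Q ∅ (fun q hq => Nat.lt_succ_iff.1 (hQ q hq)) (by simp)
    | insert p L _ ih =>
      have hL' : ∀ q ∈ L, q.natDegree ≤ d + 1 := fun q hq => hL q (Finset.mem_insert_of_mem hq)
      have hp := hL p (Finset.mem_insert_self _ _)
      rcases hp.lt_or_eq with hlt | heq
      · refine (ih (insert p Q) hL' ?_).mono ?_
        · exact (Finset.forall_mem_insert _ _ _).2 ⟨hlt, hQ⟩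
        · simp
      have hder : (derivative p).natDegree < d + 1 :=
        heq ▸ natDegree_derivative_lt (by omega)
      have herase : p.eraseLead.natDegree < d + 1 := by
        have := p.eraseLead_natDegree_le
        omega
      set Q₁ := insert (derivative p) (L ∪ Q) with hQ₁
      have hdeg₁ : ∀ q ∈ Q₁, q.natDegree ≤ p.natDegree := by
        simp only [hQ₁, Finset.mem_insert, Finset.mem_union]
        rintro q (rfl | hq | hq)
        · omega
        · exact heq ▸ hL' q hq
        · exact heq ▸ (hQ q hq).le
      have hdegi : ∀ q : A[X], ∀ i, (eraseLead^[i] q).natDegree ≤ q.natDegree := by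
        intro q i
        induction i with
        | zero => rfl
        | succ i ih =>
          rw [Function.iterate_succ_apply']
          exact eraseLead_natDegree_le_aux.trans ih
      set D := Q₁.biUnion fun q =>
        (Finset.range (q.natDegree + 1)).image fun i => divisionStep (eraseLead^[i] q) p with hD
      have hQ₀ := ih (insert (derivative p) (insert p.eraseLead (Q ∪ D))) hL' (by
        simp only [hD, Finset.mem_insert, Finset.mem_union, Finset.mem_biUnion, Finset.mem_image]
        rintro q (rfl | rfl | hq | ⟨r, hr, i, -, rfl⟩)
        · exact hder
        · exact herase
        · exact hQ q hq
        · exact heq ▸ natDegree_divisionStep_lt ((hdegi r i).trans (hdeg₁ r hr)) (by omega))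
      refine (insert_of_natDegree_pos (Q₁ := Q₁) (p := p) ?_ (Finset.mem_insert_self _ _) (by omega)
        hdeg₁ ?_ ?_ hQ₀).mono ?_
      · intro q
        simp only [hQ₁, Finset.mem_insert, Finset.mem_union]
        tauto
      · intro q hq i hi
        have : divisionStep (eraseLead^[i] q) p ∈ D := Finset.mem_biUnion.2
          ⟨q, hq, Finset.mem_image_of_mem _ (Finset.mem_range.2 (Nat.lt_succ_of_le hi))⟩
        simp [this]
      · simp
      · intro q
        simp only [hQ₁, Finset.mem_insert, Finset.mem_union]
        tauto

/-- Elimination of one variable. -/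
theorem of_finset (Q : Finset A[X]) : SignEliminable Q := by
  classical
  simpa using union_of_natDegree_le (Q.sup natDegree) Q ∅ (fun p hp => Finset.le_sup hp) (by simp)

end SignEliminable

/-- Sign conditions on finitely many elements of `A` that hold for a homomorphism to an ordered
field with the intermediate value property hold for a homomorphism to `ℝ`. -/
def HasRealSpecializations (A : Type) [CommRing A] : Prop :=
  ∀ (S : Finset A) (K : Type) [Field K] [LinearOrder K] [IsStrictOrderedRing K] (φ : A →+* K),
    PolynomialIVP K → ∃ ψ : A →+* ℝ, ∀ a ∈ S, SignType.sign (φ a) = SignType.sign (ψ a)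

namespace HasRealSpecializations

/-- Nonnegative reals are squares, so every homomorphism from $\mathbb R$ to an ordered field
preserves signs. -/
theorem real : HasRealSpecializations ℝ := fun S K _ _ _ φ _ => by
  have hmono : ∀ a : ℝ, 0 ≤ a → 0 ≤ φ a := fun a ha => by
    rw [← Real.mul_self_sqrt ha, map_mul]
    exact mul_self_nonneg _
  have hpos : ∀ a : ℝ, 0 < a → 0 < φ a := fun a ha =>
    (hmono a ha.le).lt_of_ne ((map_ne_zero φ).2 ha.ne').symm
  refine ⟨RingHom.id ℝ, fun a _ => ?_⟩
  rcases lt_trichotomy a 0 with h | rfl | h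
  · have := hpos (-a) (neg_pos.2 h)
    rw [map_neg, neg_pos] at this
    simp [sign_neg this, sign_neg h]
  · simp
  · simp [sign_pos (hpos a h), sign_pos h]

/-- First specialize the coefficients to $\mathbb R$, matching the finitely many signs that
elimination asks for; then a sign embedding of the single point `φ X` supplies the real value of the
variable. -/
theorem polynomial {A : Type} [CommRing A] (hA : HasRealSpecializations A) :
    HasRealSpecializations A[X] := fun Q K _ _ _ φ hK => by
  obtain ⟨S, hS⟩ := SignEliminable.of_finset Q
  obtain ⟨ψ, hψ⟩ := hA S K (φ.comp C) hK
  obtain ⟨s, -, hs⟩ := hS K ℝ (φ.comp C) ψ hK Real.polynomialIVP hψ {φ X}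
  refine ⟨eval₂RingHom ψ (s (φ X)), fun q hq => ?_⟩
  have := hs q hq (φ X) (Finset.mem_singleton_self _)
  rw [eval_map, eval_map] at this
  rw [coe_eval₂RingHom, ← this]
  congr 1
  have h := congrArg (fun f : A[X] →+* K => f q)
    (show eval₂RingHom (φ.comp C) (φ X) = φ by ext <;> simp)
  exact h.symm

theorem of_ringEquiv {A B : Type} [CommRing A] [CommRing B] (e : A ≃+* B)
    (hA : HasRealSpecializations A) : HasRealSpecializations B := fun S K _ _ _ φ hK => by
  classical
  obtain ⟨ψ, hψ⟩ := hA (S.image e.symm) K (φ.comp e) hK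
  refine ⟨ψ.comp e.symm, fun b hb => ?_⟩
  simpa using hψ (e.symm b) (Finset.mem_image_of_mem _ hb)

theorem mvPolynomial (n : ℕ) : HasRealSpecializations (MvPolynomial (Fin n) ℝ) := by
  induction n with
  | zero => exact of_ringEquiv (MvPolynomial.isEmptyAlgEquiv ℝ (Fin 0)).toRingEquiv.symm real
  | succ n ih => exact of_ringEquiv (MvPolynomial.finSuccEquiv ℝ n).toRingEquiv.symm ih.polynomial

end HasRealSpecializations

/-- The transfer principle: a homomorphism from `ℝ[x₁, …, xₙ]` to an ordered field with the
intermediate value property can be replaced by a real point. -/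
theorem exists_real_point_sign_eq {n : ℕ} {K : Type} [Field K] [LinearOrder K]
    [IsStrictOrderedRing K] (hK : PolynomialIVP K) (φ : MvPolynomial (Fin n) ℝ →+* K)
    (S : Finset (MvPolynomial (Fin n) ℝ)) :
    ∃ x : Fin n → ℝ, ∀ p ∈ S, SignType.sign (φ p) = SignType.sign (MvPolynomial.eval x p) := by
  obtain ⟨ψ, hψ⟩ := HasRealSpecializations.mvPolynomial n S K φ hK
  refine ⟨fun i => ψ (MvPolynomial.X i), fun p hp => ?_⟩
  have : ψ = MvPolynomial.eval fun i => ψ (MvPolynomial.X i) := by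
    refine MvPolynomial.ringHom_ext (fun r => ?_) fun i => by simp
    rw [MvPolynomial.eval_C]
    -- The identity is the only ring endomorphism of $\mathbb R$, so `ψ` is evaluation at a point.
    exact congrArg (fun f : ℝ →+* ℝ => f r) (Subsingleton.elim (ψ.comp MvPolynomial.C) (.id ℝ))
  rw [hψ p hp, ← this]

end

/-! ### Preorderings and orderings of rings. -/

/-- A set of elements of a commutative ring that is closed under sums and products and contains all
squares, but not `-1`. -/
structure IsPreordering {R : Type*} [CommRing R] (P : Set R) : Prop where
  add : ∀ {x y}, x ∈ P → y ∈ P → x + y ∈ P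
  mul : ∀ {x y}, x ∈ P → y ∈ P → x * y ∈ P
  mul_self : ∀ x, x * x ∈ P
  neg_one : (-1 : R) ∉ P

/-- The upper bound of a chain of sets that is used in applications of Zorn's lemma. -/
theorem IsChain.exists_mem_both {α : Type*} {c : Set (Set α)} (hc : IsChain (· ⊆ ·) c) {x y : α}
    (hx : x ∈ ⋃₀ c) (hy : y ∈ ⋃₀ c) : ∃ s ∈ c, x ∈ s ∧ y ∈ s := by
  obtain ⟨s, hs, hxs⟩ := hx
  obtain ⟨t, ht, hyt⟩ := hy
  rcases hc.total hs ht with h | h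
  · exact ⟨t, ht, h hxs, hyt⟩
  · exact ⟨s, hs, hxs, h hyt⟩

namespace IsPreordering

variable {R : Type*} [CommRing R]

theorem exists_maximal {T : Set R} (hT : IsPreordering T) :
    ∃ P, T ⊆ P ∧ Maximal (· ∈ {P : Set R | IsPreordering P}) P := by
  refine zorn_subset_nonempty _ (fun c hcS hc hne => ?_) T hT
  obtain ⟨s₀, hs₀⟩ := hne
  refine ⟨⋃₀ c, ⟨fun hx hy => ?_, fun hx hy => ?_, fun x => ⟨s₀, hs₀, (hcS hs₀).mul_self x⟩, ?_⟩,
    fun s hs => Set.subset_sUnion_of_mem hs⟩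
  · obtain ⟨s, hs, h1, h2⟩ := hc.exists_mem_both hx hy
    exact ⟨s, hs, (hcS hs).add h1 h2⟩
  · obtain ⟨s, hs, h1, h2⟩ := hc.exists_mem_both hx hy
    exact ⟨s, hs, (hcS hs).mul h1 h2⟩
  · rintro ⟨s, hs, h⟩
    exact (hcS hs).neg_one h

/-- $P+aP$ is closed under the same operations and is strictly larger, so by maximality it must
contain $-1$. -/
theorem neg_one_eq_of_notMem {P : Set R} (hP : Maximal (· ∈ {P : Set R | IsPreordering P}) P)
    {a : R} (ha : a ∉ P) : ∃ p ∈ P, ∃ q ∈ P, -1 = p + a * q := by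
  have h := hP.prop
  have h0 : (0 : R) ∈ P := by simpa using h.mul_self 0
  have h1 : (1 : R) ∈ P := by simpa using h.mul_self 1
  by_contra hcon
  push Not at hcon
  refine ha (hP.le_of_ge (y := {x | ∃ p ∈ P, ∃ q ∈ P, x = p + a * q}) ⟨?_, ?_, fun x => ?_, ?_⟩
    (fun x hx => ⟨x, hx, 0, h0, by ring⟩) ⟨0, h0, 1, h1, by ring⟩)
  · rintro _ _ ⟨p, hp, q, hq, rfl⟩ ⟨r, hr, s, hs, rfl⟩
    exact ⟨p + r, h.add hp hr, q + s, h.add hq hs, by ring⟩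
  · rintro _ _ ⟨p, hp, q, hq, rfl⟩ ⟨r, hr, s, hs, rfl⟩
    exact ⟨p * r + a * a * (q * s), h.add (h.mul hp hr) (h.mul (h.mul_self a) (h.mul hq hs)),
      p * s + q * r, h.add (h.mul hp hs) (h.mul hq hr), by ring⟩
  · exact ⟨x * x, h.mul_self x, 0, h0, by ring⟩
  · rintro ⟨p, hp, q, hq, h⟩
    exact hcon p hp q hq h

/-- Every preordering is contained in an ordering. -/
theorem exists_ordering {T : Set R} (hT : IsPreordering T) :
    ∃ P : RingPreordering R, P.IsOrdering ∧ T ⊆ P := by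
  obtain ⟨P, hTP, hP⟩ := hT.exists_maximal
  have h : IsPreordering P := hP.prop
  refine ⟨RingPreordering.mk' P h.add h.mul h.mul_self h.neg_one, ?_, hTP⟩
  rw [RingPreordering.isOrdering_iff]
  simp only [RingPreordering.mem_mk']
  intro a b hab
  by_contra hcon
  push Not at hcon
  obtain ⟨p, hp, q, hq, h1⟩ := neg_one_eq_of_notMem hP hcon.1
  obtain ⟨r, hr, s, hs, h2⟩ := neg_one_eq_of_notMem hP hcon.2
  refine h.neg_one ?_
  -- Multiply $1+p=-aq$ by $1+r=-bs$ and solve for $-1$.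
  have : -1 = p + r + p * r + -(a * b) * (q * s) := by linear_combination (1 + r) * h1 - a * q * h2
  rw [this]
  exact h.add (h.add (h.add hp hr) (h.mul hp hr)) (h.mul hab (h.mul hq hs))

end IsPreordering

/-! ### Maximal cones and an ordered field with the intermediate value property. -/

/-- A set of elements of a field that are the nonnegative elements of an order of the ring of its
differences, or a preordering of this ring with trivial support. -/
structure IsDifferenceCone {Ω : Type*} [Field Ω] (P : Set Ω) : Prop where
  one : (1 : Ω) ∈ P
  add : ∀ {x y}, x ∈ P → y ∈ P → x + y ∈ P
  mul : ∀ {x y}, x ∈ P → y ∈ P → x * y ∈ P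
  sq_sub : ∀ {x y}, x ∈ P → y ∈ P → (x - y) ^ 2 ∈ P
  eq_zero : ∀ {x}, x ∈ P → -x ∈ P → x = 0

namespace IsDifferenceCone

variable {Ω : Type*} [Field Ω]

theorem exists_maximal {T : Set Ω} (hT : IsDifferenceCone T) :
    ∃ P, T ⊆ P ∧ Maximal (· ∈ {P : Set Ω | IsDifferenceCone P}) P := by
  refine zorn_subset_nonempty _ (fun c hcS hc hne => ?_) T hT
  obtain ⟨s₀, hs₀⟩ := hne
  refine ⟨⋃₀ c, ⟨⟨s₀, hs₀, (hcS hs₀).one⟩, fun hx hy => ?_, fun hx hy => ?_, fun hx hy => ?_,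
    fun hx hy => ?_⟩, fun s hs => Set.subset_sUnion_of_mem hs⟩ <;>
    obtain ⟨s, hs, h1, h2⟩ := hc.exists_mem_both hx hy
  · exact ⟨s, hs, (hcS hs).add h1 h2⟩
  · exact ⟨s, hs, (hcS hs).mul h1 h2⟩
  · exact ⟨s, hs, (hcS hs).sq_sub h1 h2⟩
  · exact (hcS hs).eq_zero h1 h2

variable {P : Set Ω}

theorem zero (h : IsDifferenceCone P) : (0 : Ω) ∈ P := by simpa using h.sq_sub h.one h.one

/-- The ring of differences. -/
def differences (h : IsDifferenceCone P) : Subring Ω where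
  carrier := {x | ∃ p ∈ P, ∃ q ∈ P, x = p - q}
  mul_mem' := by
    rintro _ _ ⟨p, hp, q, hq, rfl⟩ ⟨r, hr, s, hs, rfl⟩
    exact ⟨p * r + q * s, h.add (h.mul hp hr) (h.mul hq hs), p * s + q * r,
      h.add (h.mul hp hs) (h.mul hq hr), by ring⟩
  one_mem' := ⟨1, h.one, 0, h.zero, by ring⟩
  add_mem' := by
    rintro _ _ ⟨p, hp, q, hq, rfl⟩ ⟨r, hr, s, hs, rfl⟩
    exact ⟨p + r, h.add hp hr, q + s, h.add hq hs, by ring⟩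
  zero_mem' := ⟨0, h.zero, 0, h.zero, by ring⟩
  neg_mem' := by
    rintro _ ⟨p, hp, q, hq, rfl⟩
    exact ⟨q, hq, p, hp, by ring⟩

theorem subset_differences (h : IsDifferenceCone P) {x : Ω} (hx : x ∈ P) : x ∈ h.differences :=
  ⟨x, hx, 0, h.zero, by ring⟩

theorem sq_mem (h : IsDifferenceCone P) {x : Ω} (hx : x ∈ h.differences) : x ^ 2 ∈ P := by
  obtain ⟨p, hp, q, hq, rfl⟩ := hx
  exact h.sq_sub hp hq

/-- The fractions $p/t^2$ with $p\in P$ and $t\ne0$ a difference again form a cone containing $P$;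
maximality puts them back into $P$. -/
theorem inv_sq_mem (hP : Maximal (· ∈ {P : Set Ω | IsDifferenceCone P}) P) {s : Ω}
    (hs : s ∈ (hP.prop : IsDifferenceCone P).differences) (hs0 : s ≠ 0) : (s ^ 2)⁻¹ ∈ P := by
  have h : IsDifferenceCone P := hP.prop
  refine hP.le_of_ge (y := {x | ∃ p ∈ P, ∃ t ∈ h.differences, t ≠ 0 ∧ x = p / t ^ 2})
    ⟨⟨1, h.one, 1, one_mem _, one_ne_zero, by simp⟩, ?_, ?_, ?_, ?_⟩
    (fun x hx => ⟨x, hx, 1, one_mem _, one_ne_zero, by simp⟩) ⟨1, h.one, s, hs, hs0, by simp⟩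
  · rintro _ _ ⟨p, hp, t, ht, ht0, rfl⟩ ⟨q, hq, u, hu, hu0, rfl⟩
    exact ⟨p * u ^ 2 + q * t ^ 2, h.add (h.mul hp (h.sq_mem hu)) (h.mul hq (h.sq_mem ht)), t * u,
      mul_mem ht hu, mul_ne_zero ht0 hu0, by field_simp⟩
  · rintro _ _ ⟨p, hp, t, ht, ht0, rfl⟩ ⟨q, hq, u, hu, hu0, rfl⟩
    exact ⟨p * q, h.mul hp hq, t * u, mul_mem ht hu, mul_ne_zero ht0 hu0, by field_simp⟩
  · rintro _ _ ⟨p, hp, t, ht, ht0, rfl⟩ ⟨q, hq, u, hu, hu0, rfl⟩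
    exact ⟨(p * u ^ 2 - q * t ^ 2) ^ 2,
      h.sq_sub (h.mul hp (h.sq_mem hu)) (h.mul hq (h.sq_mem ht)), (t * u) ^ 2,
      pow_mem (mul_mem ht hu) 2, pow_ne_zero 2 (mul_ne_zero ht0 hu0), by field_simp⟩
  · rintro _ ⟨p, hp, t, ht, ht0, rfl⟩ ⟨q, hq, u, hu, hu0, hpq⟩
    have h1 : -(p * u ^ 2) = q * t ^ 2 := by field_simp at hpq; linear_combination hpq
    have h2 := h.eq_zero (h.mul hp (h.sq_mem hu)) (h1 ▸ h.mul hq (h.sq_mem ht))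
    rw [(mul_eq_zero.1 h2).resolve_right (pow_ne_zero 2 hu0), zero_div]

theorem inv_mem (hP : Maximal (· ∈ {P : Set Ω | IsDifferenceCone P}) P) {s : Ω}
    (hs : s ∈ (hP.prop : IsDifferenceCone P).differences) :
    s⁻¹ ∈ (hP.prop : IsDifferenceCone P).differences := by
  have h : IsDifferenceCone P := hP.prop
  by_cases hs0 : s = 0
  · simp [hs0]
  · have : s⁻¹ = s * (s ^ 2)⁻¹ := by field_simp
    rw [this]
    exact mul_mem hs (h.subset_differences (inv_sq_mem hP hs hs0))

/-- If $x\notin P$, then $P+xP$ is too large to be a cone, and only `eq_zero` can fail. That yields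
$p+r+x(q+s)=0$ with $q+s\ne0$, so $-x=(p+r)/(q+s)$ lies in $P$. -/
theorem mem_or_neg_mem (hP : Maximal (· ∈ {P : Set Ω | IsDifferenceCone P}) P) {x : Ω}
    (hx : x ∈ (hP.prop : IsDifferenceCone P).differences) : x ∈ P ∨ -x ∈ P := by
  have h : IsDifferenceCone P := hP.prop
  by_contra hcon
  push Not at hcon
  refine hcon.1 (hP.le_of_ge (y := {y | ∃ p ∈ P, ∃ q ∈ P, y = p + x * q}) ⟨?_, ?_, ?_, ?_, ?_⟩
    (fun y hy => ⟨y, hy, 0, h.zero, by ring⟩) ⟨0, h.zero, 1, h.one, by ring⟩)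
  · exact ⟨1, h.one, 0, h.zero, by ring⟩
  · rintro _ _ ⟨p, hp, q, hq, rfl⟩ ⟨r, hr, s, hs, rfl⟩
    exact ⟨p + r, h.add hp hr, q + s, h.add hq hs, by ring⟩
  · rintro _ _ ⟨p, hp, q, hq, rfl⟩ ⟨r, hr, s, hs, rfl⟩
    exact ⟨p * r + x ^ 2 * (q * s), h.add (h.mul hp hr) (h.mul (h.sq_mem hx) (h.mul hq hs)),
      p * s + q * r, h.add (h.mul hp hs) (h.mul hq hr), by ring⟩
  · rintro _ _ ⟨p, hp, q, hq, rfl⟩ ⟨r, hr, s, hs, rfl⟩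
    have hm : ∀ {p}, p ∈ P → p ∈ h.differences := h.subset_differences
    exact ⟨(p + x * q - (r + x * s)) ^ 2, h.sq_mem (sub_mem (add_mem (hm hp) (mul_mem hx (hm hq)))
      (add_mem (hm hr) (mul_mem hx (hm hs)))), 0, h.zero, by ring⟩
  · rintro _ ⟨p, hp, q, hq, rfl⟩ ⟨r, hr, s, hs, hpq⟩
    have hz : p + r + x * (q + s) = 0 := by linear_combination -hpq
    by_cases hqs : q + s = 0
    · have hq0 := h.eq_zero hq (by rwa [neg_eq_of_add_eq_zero_right hqs])
      have hpr : p + r = 0 := by simpa [hqs] using hz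
      have hp0 := h.eq_zero hp (by rwa [neg_eq_of_add_eq_zero_right hpr])
      simp [hp0, hq0]
    · refine absurd ?_ hcon.2
      have : -x = (p + r) * (q + s) * ((q + s) ^ 2)⁻¹ := by
        field_simp
        linear_combination -hz
      rw [this]
      exact h.mul (h.mul (h.add hp hr) (h.add hq hs))
        (inv_sq_mem hP (h.subset_differences (h.add hq hs)) hqs)

end IsDifferenceCone

section

open Polynomial

namespace IsDifferenceCone

variable {Ω : Type*} [Field Ω] {P : Set Ω}

/-- The differences of a maximal cone form a field. -/
def differenceField (hP : Maximal (· ∈ {P : Set Ω | IsDifferenceCone P}) P) : Subfield Ω where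
  toSubring := (hP.prop : IsDifferenceCone P).differences
  inv_mem' _ hx := inv_mem hP hx

/-- A maximal cone as a cone in the field of its differences. -/
def ringCone (hP : Maximal (· ∈ {P : Set Ω | IsDifferenceCone P}) P) :
    RingCone (differenceField hP) where
  carrier := {x | (x : Ω) ∈ P}
  mul_mem' hx hy := IsDifferenceCone.mul hP.prop hx hy
  one_mem' := (hP.prop : IsDifferenceCone P).one
  add_mem' hx hy := IsDifferenceCone.add hP.prop hx hy
  zero_mem' := (hP.prop : IsDifferenceCone P).zero
  eq_zero_of_mem_of_neg_mem' hx hy := Subtype.ext (IsDifferenceCone.eq_zero hP.prop hx hy)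

instance (hP : Maximal (· ∈ {P : Set Ω | IsDifferenceCone P}) P) :
    HasMemOrNegMem (ringCone hP) :=
  ⟨fun x => mem_or_neg_mem hP x.2⟩

open Classical in
/-- The field of differences of a maximal cone is ordered. -/
noncomputable instance (hP : Maximal (· ∈ {P : Set Ω | IsDifferenceCone P}) P) :
    LinearOrder (differenceField hP) :=
  LinearOrder.mkOfAddGroupCone (ringCone hP)

instance (hP : Maximal (· ∈ {P : Set Ω | IsDifferenceCone P}) P) :
    IsStrictOrderedRing (differenceField hP) :=
  haveI : IsOrderedRing (differenceField hP) := IsOrderedRing.mkOfCone (ringCone hP)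
  IsOrderedRing.toIsStrictOrderedRing _

theorem nonneg_iff (hP : Maximal (· ∈ {P : Set Ω | IsDifferenceCone P}) P)
    {x : differenceField hP} : 0 ≤ x ↔ (x : Ω) ∈ P := by
  change ((x - 0 : differenceField hP) : Ω) ∈ P ↔ _
  rw [sub_zero]

end IsDifferenceCone

theorem Polynomial.exists_aeval_eq_inv {K Ω : Type*} [Field K] [Field Ω] [Algebra K Ω]
    {f : K[X]} (hf : Irreducible f) {α : Ω} (hα : aeval α f = 0) {g : K[X]}
    (hg : aeval α g ≠ 0) : ∃ u : K[X], aeval α u = (aeval α g)⁻¹ := by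
  rcases hf.isCoprime_or_dvd g with ⟨u, v, h⟩ | ⟨v, rfl⟩
  · refine ⟨v, eq_inv_of_mul_eq_one_left ?_⟩
    have := congrArg (aeval α) h
    simpa [hα] using this
  · simp [hα] at hg

theorem Polynomial.dvd_of_irreducible_of_aeval_eq_zero {K Ω : Type*} [Field K] [Field Ω]
    [Algebra K Ω] {f : K[X]} (hf : Irreducible f) {α : Ω} (hα : aeval α f = 0) {g : K[X]}
    (hg : aeval α g = 0) : f ∣ g := by
  rcases hf.isCoprime_or_dvd g with ⟨u, v, h⟩ | h
  · have := congrArg (aeval α) h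
    simp [hα, hg] at this
  · exact h

namespace IsDifferenceCone

variable {Ω : Type*} [Field Ω] {P : Set Ω}

/-- An irreducible polynomial that changes sign has a root if the polynomials of smaller degree
have the intermediate value property. -/
theorem exists_root_of_irreducible [IsAlgClosed Ω]
    (hP : Maximal (· ∈ {P : Set Ω | IsDifferenceCone P}) P)
    {f : (differenceField hP)[X]} (hf : Irreducible f) {a b : differenceField hP}
    (hab : f.eval a * f.eval b < 0)
    (ih : ∀ h : (differenceField hP)[X], h.natDegree < f.natDegree → h.eval a * h.eval b < 0 →
      ∃ c, h.eval c = 0) : ∃ c, f.eval c = 0 := by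
  have hPc : IsDifferenceCone P := hP.prop
  have hd0 : 0 < f.natDegree := hf.natDegree_pos
  obtain ⟨α, hα⟩ := IsAlgClosed.exists_aeval_eq_zero Ω f (degree_pos_of_irreducible hf).ne'
  -- The candidate cone on $K(\alpha)$, generated by `P` and all squares. If it is proper,
  -- maximality gives `Q ⊆ P`, which forces the root $\alpha$ into the difference field.
  set Q := AddSubmonoid.closure
    {y : Ω | ∃ p ∈ P, ∃ g : (differenceField hP)[X], y = p * aeval α g ^ 2} with hQ
  have hrep : ∀ y ∈ Q, ∃ q : (differenceField hP)[X], q.natDegree ≤ 2 * (f.natDegree - 1) ∧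
      (∀ c, 0 ≤ q.eval c) ∧ aeval α q = y := by
    intro y hy
    induction hy using AddSubmonoid.closure_induction with
    | mem y hy =>
      obtain ⟨p, hp, g, rfl⟩ := hy
      have hpn : 0 ≤ (⟨p, hPc.subset_differences hp⟩ : differenceField hP) :=
        (nonneg_iff hP).2 hp
      refine ⟨C ⟨p, hPc.subset_differences hp⟩ * (g % f) ^ 2, ?_, fun c => ?_, ?_⟩
      · have h1 : (g % f).natDegree < f.natDegree := natDegree_mod_lt g hd0.ne'
        have h2 : ((g % f) ^ 2).natDegree ≤ 2 * (g % f).natDegree := natDegree_pow_le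
        have h3 := natDegree_C_mul_le (⟨p, hPc.subset_differences hp⟩ : differenceField hP)
          ((g % f) ^ 2)
        omega
      · simp only [eval_mul, eval_C, eval_pow]
        positivity
      · have h1 : aeval α (g % f) = aeval α g := by
          conv_rhs => rw [← EuclideanDomain.mod_add_div g f]
          simp [hα]
        rw [map_mul, map_pow, h1, aeval_C]
        rfl
    | zero => exact ⟨0, by simp, by simp, by simp⟩
    | add x y _ _ hx hy =>
      obtain ⟨q, h1, h2, h3⟩ := hx
      obtain ⟨r, h4, h5, h6⟩ := hy
      refine ⟨q + r, (natDegree_add_le _ _).trans (max_le h1 h4), fun c => ?_, ?_⟩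
      · rw [eval_add]
        exact add_nonneg (h2 c) (h5 c)
      · rw [map_add, h3, h6]
  -- Otherwise $1+q=fh$, where reduction modulo $f$ keeps $\deg q\le 2(\deg f-1)$ and hence $\deg
  -- h<\deg f$. As $1+q>0$ everywhere, $h$ changes sign along with $f$, and its root given by
  -- induction would be a root of $1+q$.
  have hneg : (-1 : Ω) ∉ Q := by
    intro h
    obtain ⟨q, h1, h2, h3⟩ := hrep _ h
    obtain ⟨h, hh⟩ := dvd_of_irreducible_of_aeval_eq_zero hf hα (g := 1 + q) (by simp [h3])
    have hval : ∀ c, 0 < f.eval c * h.eval c := fun c => by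
      have := congrArg (eval c) hh
      rw [eval_mul, eval_add, eval_one] at this
      linarith [h2 c]
    have hh0 : h ≠ 0 := by
      rintro rfl
      simpa using hval a
    have hdeg : f.natDegree + h.natDegree ≤ 2 * (f.natDegree - 1) := by
      rw [← natDegree_mul hf.ne_zero hh0, ← hh]
      refine (natDegree_add_le _ _).trans (max_le ?_ h1)
      simp
    have hhab : h.eval a * h.eval b < 0 := by
      have h4 := mul_pos (hval a) (hval b)
      by_contra hcon
      rw [not_lt] at hcon
      nlinarith [mul_nonpos_of_nonpos_of_nonneg hab.le hcon]
    obtain ⟨c, hc⟩ := ih h (by omega) hhab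
    simpa [hc] using hval c
  have hrange : ∀ y ∈ Q, ∃ g : (differenceField hP)[X], aeval α g = y := fun y hy =>
    let ⟨q, _, _, h⟩ := hrep y hy
    ⟨q, h⟩
  have hsq : ∀ g : (differenceField hP)[X], aeval α g ^ 2 ∈ Q := fun g =>
    AddSubmonoid.subset_closure ⟨1, hPc.one, g, by ring⟩
  have hmul : ∀ x ∈ Q, ∀ y ∈ Q, x * y ∈ Q := by
    intro x hx y hy
    induction hx, hy using AddSubmonoid.closure_induction₂ with
    | mem x y hx hy =>
      obtain ⟨p, hp, g, rfl⟩ := hx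
      obtain ⟨q, hq, k, rfl⟩ := hy
      exact AddSubmonoid.subset_closure ⟨p * q, hPc.mul hp hq, g * k, by rw [map_mul]; ring⟩
    | zero_left x _ => simp
    | zero_right x _ => simp
    | add_left x y z _ _ _ h1 h2 => rw [add_mul]; exact add_mem h1 h2
    | add_right x y z _ _ _ h1 h2 => rw [mul_add]; exact add_mem h1 h2
  have hQc : IsDifferenceCone (Q : Set Ω) := by
    refine ⟨by simpa using hsq 1, fun hx hy => add_mem hx hy, fun hx hy => hmul _ hx _ hy,
      fun hx hy => ?_, fun {x} hx hy => ?_⟩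
    · obtain ⟨g, rfl⟩ := hrange _ hx
      obtain ⟨k, rfl⟩ := hrange _ hy
      rw [← map_sub]
      exact hsq _
    · by_contra hx0
      obtain ⟨g, rfl⟩ := hrange _ hx
      -- With $u=x^{-1}$, the product $x\cdot(-x)\cdot u^2$ is $-1$.
      obtain ⟨u, hu⟩ := exists_aeval_eq_inv hf hα hx0
      refine hneg ?_
      have := hmul _ (hmul _ hx _ hy) _ (hsq u)
      rw [hu] at this
      convert this using 1
      field_simp
  have hQP : (Q : Set Ω) ⊆ P := hP.le_of_ge hQc fun p hp =>
    AddSubmonoid.subset_closure ⟨p, hp, 1, by simp⟩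
  -- Squares lie in `P`, and $\alpha=((\alpha+1)/2)^2-((\alpha-1)/2)^2$.
  have hαP : α ∈ differenceField hP := by
    have h2 : (algebraMap (differenceField hP) Ω) 2⁻¹ * 2 = 1 := by
      rw [← map_ofNat (algebraMap (differenceField hP) Ω) 2, ← map_mul]
      norm_num
    refine ⟨_, hQP (hsq (C 2⁻¹ * (X + 1))), _, hQP (hsq (C 2⁻¹ * (X - 1))), ?_⟩
    simp only [map_mul, map_add, map_sub, aeval_C, aeval_X, map_one]
    linear_combination (-α * (1 + algebraMap (differenceField hP) Ω 2⁻¹ * 2)) * h2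
  refine ⟨⟨α, hαP⟩, ?_⟩
  have := hα
  rw [show α = algebraMap (differenceField hP) Ω ⟨α, hαP⟩ from rfl, aeval_algebraMap_apply] at this
  exact (map_eq_zero (algebraMap (differenceField hP) Ω)).1 this

/-- Induction on the degree. In a factorization one factor changes sign; an irreducible polynomial
that changes sign has a root, hence is linear, and the sign change puts that root between the two
points. -/
theorem polynomialIVP_differenceField [IsAlgClosed Ω]
    (hP : Maximal (· ∈ {P : Set Ω | IsDifferenceCone P}) P) :
    PolynomialIVP (differenceField hP) := by
  have key : ∀ (d : ℕ) (f : (differenceField hP)[X]), f.natDegree = d → ∀ a b, a < b →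
      f.eval a * f.eval b < 0 → ∃ c, a < c ∧ c < b ∧ f.eval c = 0 := by
    intro d
    induction d using Nat.strong_induction_on with
    | _ d ih =>
    rintro f rfl a b hab hlt
    have hf0 : f ≠ 0 := by rintro rfl; simp at hlt
    have hfu : ¬ IsUnit f := by
      intro hu
      obtain ⟨r, hr, rfl⟩ := isUnit_iff.1 hu
      simp only [eval_C] at hlt
      exact absurd hlt (not_lt.2 (mul_self_nonneg r))
    by_cases hf : Irreducible f
    · obtain ⟨c, hc⟩ := exists_root_of_irreducible hP hf hlt fun h hh hhab =>
        let ⟨c, _, _, hc⟩ := ih _ hh h rfl a b hab hhab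
        ⟨c, hc⟩
      obtain ⟨g, hg⟩ := dvd_iff_isRoot.2 hc
      have hgu : IsUnit g := (hf.isUnit_or_isUnit hg).resolve_left (not_isUnit_X_sub_C c)
      obtain ⟨r, hr, rfl⟩ := isUnit_iff.1 hgu
      have hr2 : 0 < r ^ 2 := by
        have := hr.ne_zero
        positivity
      have h1 : r ^ 2 * ((a - c) * (b - c)) < 0 := by
        rw [hg] at hlt
        simp only [eval_mul, eval_sub, eval_X, eval_C] at hlt
        linarith
      have h2 : (a - c) * (b - c) < 0 := by
        by_contra hcon
        exact absurd h1 (not_lt.2 (mul_nonneg hr2.le (not_lt.1 hcon)))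
      rcases mul_neg_iff.1 h2 with ⟨h3, h4⟩ | ⟨h3, h4⟩
      · linarith
      · exact ⟨c, by linarith, by linarith, hc⟩
    · rw [irreducible_iff] at hf
      push Not at hf
      obtain ⟨g, h, rfl, hg, hh⟩ := hf hfu
      have hg0 := left_ne_zero_of_mul hf0
      have hh0 := right_ne_zero_of_mul hf0
      have hgd : 0 < g.natDegree := Nat.pos_of_ne_zero fun h0 => hg (by
        obtain ⟨r, rfl⟩ := natDegree_eq_zero.1 h0
        exact isUnit_C.2 (isUnit_iff_ne_zero.2 fun h => hg0 (by simp [h])))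
      have hhd : 0 < h.natDegree := Nat.pos_of_ne_zero fun h0 => hh (by
        obtain ⟨r, rfl⟩ := natDegree_eq_zero.1 h0
        exact isUnit_C.2 (isUnit_iff_ne_zero.2 fun h => hh0 (by simp [h])))
      have hdeg := natDegree_mul hg0 hh0
      have hor : g.eval a * g.eval b < 0 ∨ h.eval a * h.eval b < 0 := by
        by_contra hcon
        push Not at hcon
        have := mul_nonneg hcon.1 hcon.2
        rw [eval_mul, eval_mul] at hlt
        linarith
      rcases hor with hor | hor
      · obtain ⟨c, h1, h2, h3⟩ := ih _ (by omega) g rfl a b hab hor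
        exact ⟨c, h1, h2, by simp [h3]⟩
      · obtain ⟨c, h1, h2, h3⟩ := ih _ (by omega) h rfl a b hab hor
        exact ⟨c, h1, h2, by simp [h3]⟩
  exact fun f a b hab ha hb => key _ f rfl a b hab (mul_neg_of_neg_of_pos ha hb)

end IsDifferenceCone

/-- Every preordering of a commutative ring is nonnegative under some homomorphism to an ordered
field with the intermediate value property. -/
theorem IsPreordering.exists_ringHom {R : Type} [CommRing R] {T : Set R} (hT : IsPreordering T) :
    ∃ (K : Type) (_ : Field K) (_ : LinearOrder K) (_ : IsStrictOrderedRing K) (φ : R →+* K),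
      PolynomialIVP K ∧ ∀ t ∈ T, 0 ≤ φ t := by
  obtain ⟨O, hO, hTO⟩ := hT.exists_ordering
  have hprime : O.support.IsPrime := inferInstance
  -- Dividing by the support makes the image of the ordering a cone with trivial support. Algebraic
  -- closedness supplies the roots that a maximal cone has to absorb.
  set Ω := AlgebraicClosure (FractionRing (R ⧸ O.support))
  set ψ : R →+* Ω := ((algebraMap (FractionRing (R ⧸ O.support)) Ω).comp
    (algebraMap (R ⧸ O.support) _)).comp (Ideal.Quotient.mk O.support) with hψ
  have hker : ∀ x, ψ x = 0 ↔ x ∈ O ∧ -x ∈ O := by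
    intro x
    rw [← RingPreordering.mem_support, ← Ideal.Quotient.eq_zero_iff_mem]
    simp only [hψ, RingHom.comp_apply, map_eq_zero]
    exact map_eq_zero_iff _ (IsFractionRing.injective (R ⧸ O.support) _)
  have hcone : IsDifferenceCone (ψ '' O) := by
    refine ⟨⟨1, one_mem O, map_one ψ⟩, ?_, ?_, ?_, ?_⟩
    · rintro _ _ ⟨x, hx, rfl⟩ ⟨y, hy, rfl⟩
      exact ⟨x + y, add_mem hx hy, map_add ψ x y⟩
    · rintro _ _ ⟨x, hx, rfl⟩ ⟨y, hy, rfl⟩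
      exact ⟨x * y, mul_mem hx hy, map_mul ψ x y⟩
    · rintro _ _ ⟨x, hx, rfl⟩ ⟨y, hy, rfl⟩
      exact ⟨(x - y) ^ 2, O.pow_two_mem _, by simp⟩
    · rintro _ ⟨x, hx, rfl⟩ ⟨y, hy, hxy⟩
      have h := (hker (x + y)).1 (by rw [map_add, hxy, add_neg_cancel])
      refine (hker x).2 ⟨hx, ?_⟩
      have := add_mem hy h.2
      rwa [show y + -(x + y) = -x by ring] at this
  obtain ⟨P, hOP, hP⟩ := hcone.exists_maximal
  have hmem : ∀ x, ψ x ∈ IsDifferenceCone.differenceField hP := by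
    intro x
    have hPc : IsDifferenceCone P := hP.prop
    rcases mem_or_neg_mem O x with h | h
    · exact hPc.subset_differences (hOP ⟨x, h, rfl⟩)
    · rw [← neg_neg x, map_neg]
      exact neg_mem (hPc.subset_differences (hOP ⟨-x, h, rfl⟩))
  refine ⟨IsDifferenceCone.differenceField hP, inferInstance, inferInstance, inferInstance,
    ψ.codRestrict _ hmem, IsDifferenceCone.polynomialIVP_differenceField hP, fun t ht => ?_⟩
  exact (IsDifferenceCone.nonneg_iff hP).2 (hOP ⟨t, hTO ht, rfl⟩)

end

/-! ### Quadratic modules and their bounded elements. -/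

/-- A quadratic module: a set of ring elements that contains `1` and is closed under sums and under
multiplication by squares. -/
structure IsQuadraticModule {R : Type*} [CommRing R] (M : Set R) : Prop where
  one : (1 : R) ∈ M
  add : ∀ {x y}, x ∈ M → y ∈ M → x + y ∈ M
  mul_self_mul : ∀ (x : R) {y}, y ∈ M → x * x * y ∈ M

namespace IsQuadraticModule

variable {R : Type*} [CommRing R] {M : Set R}

theorem mul_self (h : IsQuadraticModule M) (x : R) : x * x ∈ M := by
  simpa using h.mul_self_mul x h.one

theorem sq (h : IsQuadraticModule M) (x : R) : x ^ 2 ∈ M := pow_two x ▸ h.mul_self x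

theorem zero (h : IsQuadraticModule M) : (0 : R) ∈ M := by simpa using h.mul_self 0

theorem isSumSq_mul (h : IsQuadraticModule M) {s y : R} (hs : IsSumSq s) (hy : y ∈ M) :
    s * y ∈ M := by
  induction hs with
  | zero => simpa using h.zero
  | sq_add a _ ih => rw [add_mul]; exact h.add (h.mul_self_mul a hy) ih

theorem isSumSq (h : IsQuadraticModule M) {s : R} (hs : IsSumSq s) : s ∈ M := by
  simpa using h.isSumSq_mul hs h.one

theorem sum {ι : Type*} (h : IsQuadraticModule M) (I : Finset ι) {x : ι → R}
    (hx : ∀ i ∈ I, x i ∈ M) : ∑ i ∈ I, x i ∈ M := by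
  classical
  induction I using Finset.induction_on with
  | empty => simpa using h.zero
  | insert i I hi ih =>
    rw [Finset.sum_insert hi]
    exact h.add (hx i (Finset.mem_insert_self _ _))
      (ih fun j hj => hx j (Finset.mem_insert_of_mem hj))

variable [Algebra ℝ R]

theorem isSumSq_algebraMap {r : ℝ} (hr : 0 ≤ r) : IsSumSq (algebraMap ℝ R r) := by
  rw [← Real.mul_self_sqrt hr, map_mul]
  exact IsSumSq.mul_self _

theorem algebraMap_mem (h : IsQuadraticModule M) {r : ℝ} (hr : 0 ≤ r) : algebraMap ℝ R r ∈ M :=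
  h.isSumSq (isSumSq_algebraMap hr)

theorem algebraMap_mul_mem (h : IsQuadraticModule M) {r : ℝ} (hr : 0 ≤ r) {x : R} (hx : x ∈ M) :
    algebraMap ℝ R r * x ∈ M :=
  h.isSumSq_mul (isSumSq_algebraMap hr) hx

theorem add_algebraMap_mem (h : IsQuadraticModule M) {r s : ℝ} (hrs : r ≤ s) {x : R}
    (hx : algebraMap ℝ R r + x ∈ M) : algebraMap ℝ R s + x ∈ M := by
  have := h.add (h.algebraMap_mem (sub_nonneg.2 hrs)) hx
  rw [map_sub] at this
  convert this using 1
  ring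

theorem mem_of_algebraMap_mul_mem (h : IsQuadraticModule M) {r : ℝ} (hr : 0 < r) {x : R}
    (hx : algebraMap ℝ R r * x ∈ M) : x ∈ M := by
  have := h.algebraMap_mul_mem (inv_nonneg.2 hr.le) hx
  rwa [← mul_assoc, ← map_mul, inv_mul_cancel₀ hr.ne', map_one, one_mul] at this

theorem algebraMap_neg_notMem (h : IsQuadraticModule M) (hneg : (-1 : R) ∉ M) {r : ℝ}
    (hr : r < 0) : algebraMap ℝ R r ∉ M := fun hmem => hneg (by
  refine h.mem_of_algebraMap_mul_mem (neg_pos.2 hr) ?_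
  simpa using hmem)

/-- If `|p| ≤ N` modulo `M` then `p² ≤ N²` modulo `M`. -/
theorem sq_sub_sq_mem (h : IsQuadraticModule M) {N : ℝ} (hN : 0 < N) {p : R}
    (h1 : algebraMap ℝ R N - p ∈ M) (h2 : algebraMap ℝ R N + p ∈ M) :
    algebraMap ℝ R (N ^ 2) - p ^ 2 ∈ M := by
  refine h.mem_of_algebraMap_mul_mem (mul_pos two_pos hN) ?_
  have := h.add (h.mul_self_mul (algebraMap ℝ R N + p) h1)
    (h.mul_self_mul (algebraMap ℝ R N - p) h2)
  convert this using 1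
  rw [map_mul, map_pow, map_ofNat]
  ring

/-- The subalgebra of the elements that are bounded modulo a quadratic module. -/
def bounded (h : IsQuadraticModule M) : Subalgebra ℝ R :=
  have add_mem : ∀ {p q : R}, (∃ N : ℝ, algebraMap ℝ R N - p ∈ M ∧ algebraMap ℝ R N + p ∈ M) →
      (∃ N : ℝ, algebraMap ℝ R N - q ∈ M ∧ algebraMap ℝ R N + q ∈ M) →
      ∃ N : ℝ, algebraMap ℝ R N - (p + q) ∈ M ∧ algebraMap ℝ R N + (p + q) ∈ M := by
    rintro p q ⟨N, h1, h2⟩ ⟨N', h3, h4⟩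
    refine ⟨N + N', ?_, ?_⟩
    · convert h.add h1 h3 using 1
      rw [map_add]; ring
    · convert h.add h2 h4 using 1
      rw [map_add]; ring
  have sq_mem : ∀ {p : R}, (∃ N : ℝ, algebraMap ℝ R N - p ∈ M ∧ algebraMap ℝ R N + p ∈ M) →
      ∃ N : ℝ, algebraMap ℝ R N - p ^ 2 ∈ M ∧ algebraMap ℝ R N + p ^ 2 ∈ M := by
    rintro p ⟨N, h1, h2⟩
    have hle : N ≤ max N 1 := le_max_left _ _
    have hpos : 0 < max N 1 := lt_max_of_lt_right one_pos
    rw [sub_eq_add_neg] at h1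
    have h3 := h.sq_sub_sq_mem hpos (sub_eq_add_neg (algebraMap ℝ R (max N 1)) p ▸
      h.add_algebraMap_mem hle h1) (h.add_algebraMap_mem hle h2)
    exact ⟨_, h3, h.add (h.algebraMap_mem (sq_nonneg _)) (h.sq p)⟩
  { carrier := {p | ∃ N : ℝ, algebraMap ℝ R N - p ∈ M ∧ algebraMap ℝ R N + p ∈ M}
    add_mem' := add_mem
    mul_mem' := by
      intro p q hp hq
      have hnq : ∃ N : ℝ, algebraMap ℝ R N - -q ∈ M ∧ algebraMap ℝ R N + -q ∈ M := by
        obtain ⟨N, h1, h2⟩ := hq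
        exact ⟨N, by rwa [sub_neg_eq_add], by rwa [← sub_eq_add_neg]⟩
      -- Products reduce to squares by $4pq=(p+q)^2-(p-q)^2$.
      obtain ⟨N, h1, h2⟩ := sq_mem (add_mem hp hq)
      obtain ⟨N', h3, h4⟩ := sq_mem (add_mem hp hnq)
      refine ⟨(N + N') / 4, ?_, ?_⟩ <;>
        refine h.mem_of_algebraMap_mul_mem (show (0 : ℝ) < 4 by norm_num) ?_
      · convert h.add h1 h4 using 1
        rw [mul_sub, ← map_mul, mul_div_cancel₀ _ four_ne_zero, map_ofNat, map_add]
        ring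
      · convert h.add h2 h3 using 1
        rw [mul_add, ← map_mul, mul_div_cancel₀ _ four_ne_zero, map_ofNat, map_add]
        ring
    algebraMap_mem' := by
      intro r
      refine ⟨|r|, ?_, ?_⟩
      · rw [← map_sub]
        exact h.algebraMap_mem (sub_nonneg.2 (le_abs_self r))
      · rw [← map_add]
        exact h.algebraMap_mem (by linarith [neg_abs_le r]) }

theorem mem_bounded (h : IsQuadraticModule M) {p : R} : p ∈ h.bounded ↔
    ∃ N : ℝ, algebraMap ℝ R N - p ∈ M ∧ algebraMap ℝ R N + p ∈ M := Iff.rfl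

/-- The bounded elements form a subalgebra, so the variables suffice, and $N+\tfrac14\mp
x_i=(N-x_i^2)+(x_i\mp\tfrac12)^2$. -/
theorem bounded_eq_top_of_sum_sq {n : ℕ} {M : Set (MvPolynomial (Fin n) ℝ)}
    (h : IsQuadraticModule M) {N : ℝ}
    (hN : MvPolynomial.C N - ∑ i, MvPolynomial.X i ^ 2 ∈ M) : h.bounded = ⊤ := by
  rw [eq_top_iff, ← MvPolynomial.adjoin_range_X, Algebra.adjoin_le_iff]
  rintro _ ⟨i, rfl⟩
  have h1 : algebraMap ℝ (MvPolynomial (Fin n) ℝ) N - MvPolynomial.X i ^ 2 ∈ M := by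
    have := h.add hN (h.sum (Finset.univ.erase i)
      (x := fun j => (MvPolynomial.X j : MvPolynomial (Fin n) ℝ) ^ 2) fun j _ => h.sq _)
    rw [← Finset.add_sum_erase _ _ (Finset.mem_univ i)] at this
    convert this using 1
    rw [MvPolynomial.algebraMap_eq]
    ring
  have h4 : (algebraMap ℝ (MvPolynomial (Fin n) ℝ) (1 / 2)) * 2 = 1 := by
    rw [← map_ofNat (algebraMap ℝ (MvPolynomial (Fin n) ℝ)) 2, ← map_mul]
    norm_num
  refine ⟨N + (1 / 2) ^ 2, ?_, ?_⟩
  · convert h.add h1 (h.sq (MvPolynomial.X i - algebraMap ℝ _ (1 / 2))) using 1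
    rw [map_add, map_pow]
    linear_combination MvPolynomial.X i * h4
  · convert h.add h1 (h.sq (MvPolynomial.X i + algebraMap ℝ _ (1 / 2))) using 1
    rw [map_add, map_pow]
    linear_combination -MvPolynomial.X i * h4

end IsQuadraticModule

/-! ### Positivstellensatz -/

/-- The preordering generated by a preordering and one more element. -/
def Subsemiring.adjoinNonneg {R : Type*} [CommRing R] (T : Subsemiring R)
    (hT : ∀ x, x * x ∈ T) (h : R) : Subsemiring R where
  carrier := {x | ∃ u ∈ T, ∃ v ∈ T, x = u + h * v}
  mul_mem' := by
    rintro _ _ ⟨p, hp, q, hq, rfl⟩ ⟨r, hr, s, hs, rfl⟩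
    exact ⟨p * r + h * h * (q * s), add_mem (mul_mem hp hr) (mul_mem (hT h) (mul_mem hq hs)),
      p * s + q * r, add_mem (mul_mem hp hs) (mul_mem hq hr), by ring⟩
  one_mem' := ⟨1, one_mem T, 0, zero_mem T, by ring⟩
  add_mem' := by
    rintro _ _ ⟨p, hp, q, hq, rfl⟩ ⟨r, hr, s, hs, rfl⟩
    exact ⟨p + r, add_mem hp hr, q + s, add_mem hq hs, by ring⟩
  zero_mem' := ⟨0, zero_mem T, 0, zero_mem T, by ring⟩

namespace Subsemiring

variable {R : Type*} [CommRing R] {T : Subsemiring R}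

theorem le_adjoinNonneg (hT : ∀ x, x * x ∈ T) (h : R) : T ≤ T.adjoinNonneg hT h :=
  fun x hx => ⟨x, hx, 0, zero_mem T, by ring⟩

theorem self_mem_adjoinNonneg (hT : ∀ x, x * x ∈ T) (h : R) : h ∈ T.adjoinNonneg hT h :=
  ⟨0, zero_mem T, 1, one_mem T, by ring⟩

theorem mul_self_mem_adjoinNonneg (hT : ∀ x, x * x ∈ T) (h x : R) :
    x * x ∈ T.adjoinNonneg hT h :=
  le_adjoinNonneg hT h (hT x)

theorem isQuadraticModule (hT : ∀ x, x * x ∈ T) : IsQuadraticModule (T : Set R) :=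
  ⟨one_mem T, add_mem, fun x _ hy => mul_mem (hT x) hy⟩

end Subsemiring

/-- The Positivstellensatz: a preordering of `ℝ[x₁, …, xₙ]` such that no point of `ℝⁿ` makes the
finitely many elements `S` of it nonnegative contains `-1`. -/
theorem neg_one_mem_of_forall_exists_eval_neg {n : ℕ} (T : Subsemiring (MvPolynomial (Fin n) ℝ))
    (hT : ∀ x, x * x ∈ T) (S : Finset (MvPolynomial (Fin n) ℝ)) (hS : ∀ p ∈ S, p ∈ T)
    (h : ∀ x, ∃ p ∈ S, MvPolynomial.eval x p < 0) : -1 ∈ T := by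
  by_contra hneg
  -- A preordering without $-1$ is nonnegative in some ordered field; transfer moves the signs on
  -- `S` to a real point.
  obtain ⟨K, _, _, _, φ, hK, hφ⟩ := IsPreordering.exists_ringHom
    (T := (T : Set (MvPolynomial (Fin n) ℝ))) ⟨add_mem, mul_mem, hT, hneg⟩
  obtain ⟨x, hx⟩ := exists_real_point_sign_eq hK φ S
  obtain ⟨p, hp, hlt⟩ := h x
  have h1 := hx p hp
  rw [sign_neg hlt, sign_eq_neg_one_iff] at h1
  exact absurd h1 (not_lt.2 (hφ p (hS p hp)))

/-- If `ρ` is nonnegative only on a bounded set then some `M - x₁² - ⋯ - xₙ²` has a representation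
`σ₀ + ρ σ₁` with sums of squares `σ₀`, `σ₁`. -/
theorem exists_sub_sum_sq_eq {n : ℕ} (ρ : MvPolynomial (Fin n) ℝ)
    (hρ : Bornology.IsBounded {x : Fin n → ℝ | 0 ≤ MvPolynomial.eval x ρ}) :
    ∃ (N : ℝ) (σ₀ σ₁ : MvPolynomial (Fin n) ℝ), IsSumSq σ₀ ∧ IsSumSq σ₁ ∧
      MvPolynomial.C N - ∑ i, MvPolynomial.X i ^ 2 = σ₀ + ρ * σ₁ := by
  have hsq : ∀ x : MvPolynomial (Fin n) ℝ, x * x ∈ Subsemiring.sumSq (MvPolynomial (Fin n) ℝ) :=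
    fun x => Subsemiring.mem_sumSq.2 (IsSumSq.mul_self x)
  set T := (Subsemiring.sumSq (MvPolynomial (Fin n) ℝ)).adjoinNonneg hsq ρ with hTdef
  have hT : ∀ x, x * x ∈ T := Subsemiring.mul_self_mem_adjoinNonneg hsq ρ
  have hTq := Subsemiring.isQuadraticModule hT
  obtain ⟨r, hr⟩ := hρ.exists_norm_le
  -- The sup norm is at most $r$ where $\rho\ge0$, so $\sum x_i^2<N$ there.
  set N : ℝ := n * r ^ 2 + 1 with hN
  have hN0 : 0 ≤ N := by positivity
  set a : MvPolynomial (Fin n) ℝ := ∑ i, MvPolynomial.X i ^ 2 with ha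
  have haT : a ∈ T := hTq.sum _ fun i _ => hTq.sq _
  have hneg := neg_one_mem_of_forall_exists_eval_neg (T.adjoinNonneg hT (a - MvPolynomial.C N))
    (Subsemiring.mul_self_mem_adjoinNonneg hT _) {ρ, a - MvPolynomial.C N}
    (by
      simp only [Finset.mem_insert, Finset.mem_singleton, forall_eq_or_imp, forall_eq]
      exact ⟨Subsemiring.le_adjoinNonneg hT _ (Subsemiring.self_mem_adjoinNonneg hsq ρ),
        Subsemiring.self_mem_adjoinNonneg hT _⟩)
    (by
      intro x
      by_cases hx : 0 ≤ MvPolynomial.eval x ρ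
      · refine ⟨a - MvPolynomial.C N, by simp, ?_⟩
        have h1 : ∑ i, x i ^ 2 ≤ n * r ^ 2 := by
          calc ∑ i, x i ^ 2 ≤ ∑ _i : Fin n, r ^ 2 := Finset.sum_le_sum fun i _ =>
                sq_le_sq' (neg_le_of_abs_le ((norm_le_pi_norm x i).trans (hr x hx)))
                  (le_of_abs_le ((norm_le_pi_norm x i).trans (hr x hx)))
            _ = n * r ^ 2 := by simp
        simp only [ha, map_sub, map_sum, map_pow, MvPolynomial.eval_X, MvPolynomial.eval_C]
        linarith
      · exact ⟨ρ, by simp, not_le.1 hx⟩)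
  obtain ⟨t, ht, s, hs, hst⟩ := hneg
  -- From $-1=t+(a-N)s$ the product is $s(N-a)^2$. It remains to remove the factor $1+t$.
  have h1 : (1 + t) * (MvPolynomial.C N - a) ∈ T := by
    have : (1 + t) * (MvPolynomial.C N - a)
        = s * ((MvPolynomial.C N - a) * (MvPolynomial.C N - a)) := by
      linear_combination (a - MvPolynomial.C N) * hst
    rw [this]
    exact mul_mem hs (hT _)
  have h1t : 1 + t ∈ T := add_mem (one_mem T) ht
  -- Adjoining $N-a$ makes every polynomial bounded, so $m-t=u+(N-a)v$. Multiplying by $1+t$ returns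
  -- to `T`.
  have hT₁ := Subsemiring.isQuadraticModule
    (Subsemiring.mul_self_mem_adjoinNonneg hT (MvPolynomial.C N - a))
  have htop := hT₁.bounded_eq_top_of_sum_sq (N := N) (Subsemiring.self_mem_adjoinNonneg hT _)
  obtain ⟨m, ⟨u, hu, v, hv, huv⟩, -⟩ := hT₁.mem_bounded.1 (htop ▸ Algebra.mem_top (x := t))
  have h2 : (1 + t) * (algebraMap ℝ _ m - t) ∈ T := by
    rw [huv, mul_add, ← mul_assoc]
    exact add_mem (mul_mem h1t hu) (mul_mem h1 hv)
  have h4 : (algebraMap ℝ (MvPolynomial (Fin n) ℝ) (m / 2)) * 2 = algebraMap ℝ _ m := by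
    rw [← map_ofNat (algebraMap ℝ (MvPolynomial (Fin n) ℝ)) 2, ← map_mul]
    norm_num
  -- $(1+t)(m-t)+(m/2-t)^2=m+m^2/4-t$, so $t$ is bounded above modulo `T` itself.
  have h3 : algebraMap ℝ _ (m + (m / 2) ^ 2) - t ∈ T := by
    convert add_mem h2 (hT (algebraMap ℝ _ (m / 2) - t)) using 1
    rw [map_add, map_pow]
    linear_combination t * h4
  -- The sum $(1+t)(N-a)+ta+N(m+m^2/4-t)$, in which all terms with $t$ cancel.
  have h5 : MvPolynomial.C (N * (1 + (m + (m / 2) ^ 2))) - a ∈ T := by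
    convert add_mem (add_mem h1 (mul_mem ht haT)) (hTq.algebraMap_mul_mem hN0 h3) using 1
    rw [map_mul, map_add MvPolynomial.C 1, map_one, MvPolynomial.algebraMap_eq]
    ring
  obtain ⟨σ₀, h₀, σ₁, h₁, h⟩ := h5
  exact ⟨_, σ₀, σ₁, Subsemiring.mem_sumSq.1 h₀, Subsemiring.mem_sumSq.1 h₁, h⟩

/-! ### Maximal quadratic modules and real points. -/

namespace IsQuadraticModule

variable {R : Type*} [CommRing R] {M : Set R}

theorem exists_maximal (h : IsQuadraticModule M) (hneg : (-1 : R) ∉ M) :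
    ∃ P, M ⊆ P ∧ Maximal (· ∈ {P : Set R | IsQuadraticModule P ∧ -1 ∉ P}) P := by
  refine zorn_subset_nonempty _ (fun c hcS hc hne => ?_) M ⟨h, hneg⟩
  obtain ⟨s₀, hs₀⟩ := hne
  refine ⟨⋃₀ c, ⟨⟨⟨s₀, hs₀, (hcS hs₀).1.one⟩, fun hx hy => ?_, fun x y hy => ?_⟩, ?_⟩,
    fun s hs => Set.subset_sUnion_of_mem hs⟩
  · obtain ⟨s, hs, h1, h2⟩ := hc.exists_mem_both hx hy
    exact ⟨s, hs, (hcS hs).1.add h1 h2⟩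
  · obtain ⟨s, hs, h1⟩ := hy
    exact ⟨s, hs, (hcS hs).1.mul_self_mul x h1⟩
  · rintro ⟨s, hs, h⟩
    exact (hcS hs).2 h

/-- The quadratic module generated by a quadratic module and one more element. -/
theorem adjoin (h : IsQuadraticModule M) (a : R) :
    IsQuadraticModule {x | ∃ m ∈ M, ∃ s, IsSumSq s ∧ x = m + s * a} := by
  refine ⟨⟨1, h.one, 0, IsSumSq.zero, by ring⟩, ?_, ?_⟩
  · rintro _ _ ⟨m, hm, s, hs, rfl⟩ ⟨m', hm', s', hs', rfl⟩
    exact ⟨m + m', h.add hm hm', s + s', hs.add hs', by ring⟩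
  · rintro x _ ⟨m, hm, s, hs, rfl⟩
    exact ⟨x * x * m, h.mul_self_mul x hm, x * x * s, (IsSumSq.mul_self x).mul hs, by ring⟩

theorem neg_one_eq_of_notMem (hM : Maximal (· ∈ {P : Set R | IsQuadraticModule P ∧ -1 ∉ P}) M)
    {a : R} (ha : a ∉ M) : ∃ m ∈ M, ∃ s, IsSumSq s ∧ -1 = m + s * a := by
  have h : IsQuadraticModule M := hM.prop.1
  by_contra hcon
  exact ha (hM.le_of_ge (y := {x | ∃ m ∈ M, ∃ s, IsSumSq s ∧ x = m + s * a}) ⟨h.adjoin a, hcon⟩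
    (fun x hx => ⟨x, hx, 0, IsSumSq.zero, by ring⟩) ⟨0, h.zero, 1, IsSumSq.one, by ring⟩)

variable [Algebra ℝ R]

/-- $4yx=(y+1)^2x+(y-1)^2(-x)$; thus $M\cap -M$ absorbs multiplication. -/
theorem mul_mem_of_neg_mem (h : IsQuadraticModule M) {x : R} (h1 : x ∈ M) (h2 : -x ∈ M) (y : R) :
    y * x ∈ M := by
  refine h.mem_of_algebraMap_mul_mem (show (0 : ℝ) < 4 by norm_num) ?_
  convert h.add (h.mul_self_mul (y + 1) h1) (h.mul_self_mul (y - 1) h2) using 1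
  rw [map_ofNat]
  ring

/-- If neither belongs, $-1=m+sa=m'-s'a$. Eliminating $a$ shows $-s\in M$, so $s$ is in the support,
hence so is $sa$, and $-1=m+sa\in M$. -/
theorem mem_or_neg_mem (hM : Maximal (· ∈ {P : Set R | IsQuadraticModule P ∧ -1 ∉ P}) M)
    (a : R) : a ∈ M ∨ -a ∈ M := by
  obtain ⟨h, hneg⟩ : IsQuadraticModule M ∧ -1 ∉ M := hM.prop
  by_contra hcon
  push Not at hcon
  obtain ⟨m, hm, s, hs, h1⟩ := neg_one_eq_of_notMem hM hcon.1
  obtain ⟨m', hm', s', hs', h2⟩ := neg_one_eq_of_notMem hM hcon.2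
  have hsneg : -s ∈ M := by
    have : -s = s' + (s' * m + s * m') := by linear_combination s' * h1 + s * h2
    rw [this]
    exact h.add (h.isSumSq hs') (h.add (h.isSumSq_mul hs' hm) (h.isSumSq_mul hs hm'))
  refine hneg ?_
  rw [h1, mul_comm s a]
  exact h.add hm (h.mul_mem_of_neg_mem (h.isSumSq hs) hsneg a)

/-- The supremum of the reals below `p`, in the order given by a quadratic module. -/
noncomputable def value (M : Set R) (p : R) : ℝ := sSup {r : ℝ | p - algebraMap ℝ R r ∈ M}

section Value

variable (h : IsQuadraticModule M) (hneg : (-1 : R) ∉ M) (hb : h.bounded = ⊤)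

include h hneg in
theorem le_of_sub_mem {p : R} {r s : ℝ} (h1 : p - algebraMap ℝ R r ∈ M)
    (h2 : algebraMap ℝ R s - p ∈ M) : r ≤ s := by
  by_contra hcon
  refine h.algebraMap_neg_notMem hneg (r := s - r) (by linarith) ?_
  rw [map_sub]
  convert h.add h1 h2 using 1
  ring

include h hneg in
-- $M$ is not assumed closed under limits, so the bounds that pin down the value are required only
-- up to every $\varepsilon>0$.
theorem value_eq {p : R} {c : ℝ} (h1 : ∀ ε > 0, algebraMap ℝ R ε + (p - algebraMap ℝ R c) ∈ M)
    (h2 : ∀ ε > 0, algebraMap ℝ R ε - (p - algebraMap ℝ R c) ∈ M) : value M p = c := by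
  have h1' : ∀ ε > 0, p - algebraMap ℝ R (c - ε) ∈ M := fun ε hε => by
    convert h1 ε hε using 1
    rw [map_sub]; ring
  have h2' : ∀ ε > 0, algebraMap ℝ R (c + ε) - p ∈ M := fun ε hε => by
    convert h2 ε hε using 1
    rw [map_add]; ring
  refine le_antisymm (le_of_forall_pos_le_add fun ε hε => ?_)
    (le_of_forall_pos_le_add fun ε hε => ?_)
  · exact csSup_le ⟨c - 1, h1' 1 one_pos⟩ fun r hr => h.le_of_sub_mem hneg hr (h2' ε hε)
  · have : c - ε ≤ value M p :=
      le_csSup ⟨c + 1, fun r hr => h.le_of_sub_mem hneg hr (h2' 1 one_pos)⟩ (h1' ε hε)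
    linarith

include hb in
theorem nonempty_bddAbove_lower (hneg : (-1 : R) ∉ M) (p : R) :
    {r : ℝ | p - algebraMap ℝ R r ∈ M}.Nonempty ∧
      BddAbove {r : ℝ | p - algebraMap ℝ R r ∈ M} := by
  obtain ⟨N, h1, h2⟩ := h.mem_bounded.1 (hb ▸ Algebra.mem_top (x := p))
  refine ⟨⟨-N, ?_⟩, ⟨N, fun r hr => h.le_of_sub_mem hneg hr h1⟩⟩
  change p - algebraMap ℝ R (-N) ∈ M
  rw [map_neg, sub_neg_eq_add, add_comm]
  exact h2

include hneg hb in
theorem add_sub_value_mem (p : R) {ε : ℝ} (hε : 0 < ε) :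
    algebraMap ℝ R ε + (p - algebraMap ℝ R (value M p)) ∈ M := by
  obtain ⟨r, hr, hlt⟩ := exists_lt_of_lt_csSup (h.nonempty_bddAbove_lower hb hneg p).1
    (show value M p - ε < value M p by linarith)
  have hr' : p - algebraMap ℝ R r ∈ M := hr
  convert h.add hr' (h.algebraMap_mem (show 0 ≤ r - (value M p - ε) by linarith)) using 1
  rw [map_sub, map_sub]; ring

include hneg hb in
theorem sub_sub_value_mem (htot : ∀ a, a ∈ M ∨ -a ∈ M) (p : R) {ε : ℝ} (hε : 0 < ε) :
    algebraMap ℝ R ε - (p - algebraMap ℝ R (value M p)) ∈ M := by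
  refine (htot _).resolve_right fun hcon => ?_
  have : p - algebraMap ℝ R (value M p + ε) ∈ M := by
    convert hcon using 1
    rw [map_add]; ring
  have := le_csSup (h.nonempty_bddAbove_lower hb hneg p).2 this
  rw [← value] at this
  linarith

end Value

/-- An archimedean proper quadratic module is nonnegative under a homomorphism to `ℝ`. -/
theorem exists_algHom (h : IsQuadraticModule M) (hneg : (-1 : R) ∉ M) (hb : h.bounded = ⊤) :
    ∃ φ : R →ₐ[ℝ] ℝ, ∀ m ∈ M, 0 ≤ φ m := by
  obtain ⟨P, hMP, hP⟩ := h.exists_maximal hneg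
  obtain ⟨hq, hPneg⟩ : IsQuadraticModule P ∧ -1 ∉ P := hP.prop
  have hPb : hq.bounded = ⊤ := by
    rw [eq_top_iff, ← hb]
    rintro p ⟨N, h1, h2⟩
    exact ⟨N, hMP h1, hMP h2⟩
  have htot := mem_or_neg_mem hP
  have hlow := fun (p : R) {ε : ℝ} (hε : 0 < ε) => hq.add_sub_value_mem hPneg hPb p hε
  have hupp := fun (p : R) {ε : ℝ} (hε : 0 < ε) => hq.sub_sub_value_mem hPneg hPb htot p hε
  have hconst : ∀ r : ℝ, value P (algebraMap ℝ R r) = r := fun r =>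
    hq.value_eq hPneg (fun ε hε => by simpa using hq.algebraMap_mem (R := R) hε.le)
      (fun ε hε => by simpa using hq.algebraMap_mem (R := R) hε.le)
  have hadd : ∀ p q, value P (p + q) = value P p + value P q := fun p q =>
    hq.value_eq hPneg
      (fun ε hε => by
        convert hq.add (hlow p (half_pos hε)) (hlow q (half_pos hε)) using 1
        rw [map_add]
        conv_lhs => rw [← add_halves ε, map_add]
        ring)
      (fun ε hε => by
        convert hq.add (hupp p (half_pos hε)) (hupp q (half_pos hε)) using 1
        rw [map_add]
        conv_lhs => rw [← add_halves ε, map_add]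
        ring)
  have hzero : value P 0 = 0 := by simpa using hconst 0
  have hnegv : ∀ p, value P (-p) = -value P p := fun p => by
    have := hadd p (-p)
    rw [add_neg_cancel, hzero] at this
    linarith
  have hsmul_pos : ∀ (r : ℝ) (p : R), 0 < r → value P (algebraMap ℝ R r * p) = r * value P p := by
    intro r p hr
    refine hq.value_eq hPneg (fun ε hε => ?_) (fun ε hε => ?_)
    · convert hq.algebraMap_mul_mem hr.le (hlow p (div_pos hε hr)) using 1
      rw [mul_add, ← map_mul, mul_div_cancel₀ _ hr.ne', map_mul]
      ring
    · convert hq.algebraMap_mul_mem hr.le (hupp p (div_pos hε hr)) using 1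
      rw [mul_sub, ← map_mul, mul_div_cancel₀ _ hr.ne', map_mul]
      ring
  have hsmul : ∀ (r : ℝ) (p : R), value P (algebraMap ℝ R r * p) = r * value P p := by
    intro r p
    rcases lt_trichotomy r 0 with hr | rfl | hr
    · have := hsmul_pos (-r) p (neg_pos.2 hr)
      rw [map_neg, neg_mul, hnegv] at this
      linarith
    · simp [hzero]
    · exact hsmul_pos r p hr
  -- With $v$ the value of $p$, $|p-v|\le\sqrt\varepsilon$ modulo `P` gives
  -- $0\le(p-v)^2\le\varepsilon$, so $(p-v)^2$ has value $0$. Polarization then gives products.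
  have hsq : ∀ p, value P (p ^ 2) = value P p ^ 2 := by
    intro p
    have h0 : value P ((p - algebraMap ℝ R (value P p)) ^ 2) = 0 := by
      refine hq.value_eq hPneg (fun ε hε => ?_) (fun ε hε => ?_)
      · rw [map_zero, sub_zero]
        exact hq.add (hq.algebraMap_mem hε.le) (hq.sq _)
      · rw [map_zero, sub_zero]
        have := hq.sq_sub_sq_mem (Real.sqrt_pos.2 hε) (hupp p (Real.sqrt_pos.2 hε))
          (hlow p (Real.sqrt_pos.2 hε))
        rwa [Real.sq_sqrt hε.le] at this
    have h1 : (p - algebraMap ℝ R (value P p)) ^ 2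
        = p ^ 2 + (algebraMap ℝ R (-2 * value P p) * p + algebraMap ℝ R (value P p ^ 2)) := by
      simp only [map_mul, map_neg, map_pow, map_ofNat]
      ring
    rw [h1, hadd, hadd, hsmul, hconst] at h0
    linarith
  have hmul : ∀ p q, value P (p * q) = value P p * value P q := by
    intro p q
    have h1 : algebraMap ℝ R 4 * (p * q) = (p + q) ^ 2 + -(p + -q) ^ 2 := by
      rw [map_ofNat]; ring
    have h2 := hsmul 4 (p * q)
    rw [h1, hadd, hnegv, hsq, hsq, hadd, hadd, hnegv] at h2
    linarith
  refine ⟨{ toFun := value P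
            map_one' := by simpa using hconst 1
            map_mul' := hmul
            map_zero' := hzero
            map_add' := hadd
            commutes' := hconst }, fun m hm => ?_⟩
  exact le_csSup (hq.nonempty_bddAbove_lower hPb hPneg m).2 (by simpa using hMP hm)

/-- If `σ f ≥ 1` modulo an archimedean quadratic module for a sum of squares `σ` then `f ≥ 0`. -/
theorem mem_of_isSumSq_mul_sub_one_mem (h : IsQuadraticModule M) (hb : h.bounded = ⊤) {f s : R}
    (hs : IsSumSq s) (hsf : s * f - 1 ∈ M) : f ∈ M := by
  obtain ⟨N₁, h1, -⟩ := h.mem_bounded.1 (hb ▸ Algebra.mem_top (x := s))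
  obtain ⟨N₂, h2, -⟩ := h.mem_bounded.1 (hb ▸ Algebra.mem_top (x := s ^ 2 * f))
  obtain ⟨N₃, -, h3⟩ := h.mem_bounded.1 (hb ▸ Algebra.mem_top (x := f))
  set k : ℝ := max 1 (max N₁ (N₂ + 1)) with hk
  have hk1 : 1 ≤ k := le_max_left _ _
  have hkN₁ : N₁ ≤ k := (le_max_left _ _).trans (le_max_right _ _)
  have hkN₂ : N₂ + 1 ≤ k := (le_max_right _ _).trans (le_max_right _ _)
  have h1' : algebraMap ℝ R (2 * k) - s ∈ M := by
    rw [sub_eq_add_neg] at h1 ⊢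
    exact h.add_algebraMap_mem (by linarith) h1
  have h2' : algebraMap ℝ R (2 * k - 1) - s ^ 2 * f ∈ M := by
    rw [sub_eq_add_neg] at h2 ⊢
    exact h.add_algebraMap_mem (by linarith) h2
  have hkpos : 0 < k ^ 2 := by positivity
  -- The identity $k^2(r+f)-1=(k-s)^2(r+f)+2k(sf-1)+rs(2k-s)+(2k-1-s^2f)$ lowers $r$ by the fixed
  -- amount $1/k^2$, so finitely many steps take it below zero.
  have step : ∀ r : ℝ, 0 ≤ r → algebraMap ℝ R r + f ∈ M →
      algebraMap ℝ R (r - 1 / k ^ 2) + f ∈ M := by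
    intro r hr hmem
    refine h.mem_of_algebraMap_mul_mem hkpos ?_
    have e := h.add (h.add (h.add (h.mul_self_mul (algebraMap ℝ R k - s) hmem)
      (h.algebraMap_mul_mem (show 0 ≤ 2 * k by linarith) hsf))
      (h.algebraMap_mul_mem hr (h.isSumSq_mul hs h1'))) h2'
    convert e using 1
    rw [mul_add, ← map_mul, mul_sub, mul_div_cancel₀ _ hkpos.ne']
    simp only [map_sub, map_mul, map_pow, map_ofNat, map_one]
    ring
  have key : ∀ n : ℕ, f ∈ M ∨
      0 ≤ max N₃ 0 - n * (1 / k ^ 2) ∧ algebraMap ℝ R (max N₃ 0 - n * (1 / k ^ 2)) + f ∈ M := by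
    intro n
    induction n with
    | zero =>
      right
      simp only [Nat.cast_zero, zero_mul, sub_zero]
      exact ⟨le_max_right _ _, h.add_algebraMap_mem (le_max_left _ _) h3⟩
    | succ n ih =>
      rcases ih with ih | ⟨ih1, ih2⟩
      · exact Or.inl ih
      have := step _ ih1 ih2
      rw [show max N₃ 0 - n * (1 / k ^ 2) - 1 / k ^ 2
        = max N₃ 0 - ((n + 1 : ℕ) : ℝ) * (1 / k ^ 2) by push_cast; ring] at this
      rcases le_or_gt 0 (max N₃ 0 - ((n + 1 : ℕ) : ℝ) * (1 / k ^ 2)) with hle | hlt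
      · exact Or.inr ⟨hle, this⟩
      · left
        simpa using h.add_algebraMap_mem hlt.le this
  obtain ⟨n, hn⟩ := exists_nat_gt (max N₃ 0 * k ^ 2)
  refine (key n).resolve_right fun hcon => ?_
  have h4 : max N₃ 0 < n * (1 / k ^ 2) := by
    rw [mul_one_div, lt_div_iff₀ hkpos]
    exact hn
  linarith [hcon.1]

end IsQuadraticModule

/-! ### Putinar's Positivstellensatz. -/

section Putinar

variable {n m : ℕ}

theorem isQuadraticModule_quadraticModule (f : Fin m → MvPolynomial (Fin n) ℝ) :
    IsQuadraticModule (quadraticModule f) := by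
  refine ⟨⟨1, fun _ => 0, IsSumSq.one, fun _ => IsSumSq.zero, by simp⟩, ?_, ?_⟩
  · rintro _ _ ⟨s₀, s, hs₀, hs, rfl⟩ ⟨t₀, t, ht₀, ht, rfl⟩
    refine ⟨s₀ + t₀, fun j => s j + t j, hs₀.add ht₀, fun j => (hs j).add (ht j), ?_⟩
    simp only [add_mul, Finset.sum_add_distrib]
    ring
  · rintro x _ ⟨s₀, s, hs₀, hs, rfl⟩
    refine ⟨x * x * s₀, fun j => x * x * s j, (IsSumSq.mul_self x).mul hs₀,
      fun j => (IsSumSq.mul_self x).mul (hs j), ?_⟩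
    rw [mul_add, Finset.mul_sum]
    simp only [mul_assoc]

theorem mem_quadraticModule (f : Fin m → MvPolynomial (Fin n) ℝ) (j : Fin m) :
    f j ∈ quadraticModule f := by
  refine ⟨0, fun i => if i = j then 1 else 0, IsSumSq.zero, fun i => ?_, by simp⟩
  dsimp only
  split_ifs
  · exact IsSumSq.one
  · exact IsSumSq.zero

/-- If a quadratic module contains a polynomial that is nonnegative only on a bounded set then every
polynomial is bounded modulo it. -/
theorem bounded_eq_top_of_isArchimedeanQmod {f : Fin m → MvPolynomial (Fin n) ℝ}
    (hf : IsArchimedeanQmod f) : (isQuadraticModule_quadraticModule f).bounded = ⊤ := by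
  obtain ⟨ρ, hρ, hb⟩ := hf
  obtain ⟨N, s₀, s₁, h₀, h₁, h⟩ := exists_sub_sum_sq_eq ρ hb
  have hq := isQuadraticModule_quadraticModule f
  refine hq.bounded_eq_top_of_sum_sq (N := N) ?_
  rw [h, mul_comm]
  exact hq.add (hq.isSumSq h₀) (hq.isSumSq_mul h₁ hρ)

/-- Putinar's Positivstellensatz. -/
theorem mem_quadraticModule_of_pos {f : Fin m → MvPolynomial (Fin n) ℝ} (hf : IsArchimedeanQmod f)
    {p : MvPolynomial (Fin n) ℝ} (hp : ∀ x ∈ basicSet f, 0 < MvPolynomial.eval x p) :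
    p ∈ quadraticModule f := by
  have hq := isQuadraticModule_quadraticModule f
  have hb := bounded_eq_top_of_isArchimedeanQmod hf
  have hq' := hq.adjoin (-p)
  have hsub : ∀ x ∈ quadraticModule f,
      x ∈ {x | ∃ m ∈ quadraticModule f, ∃ s, IsSumSq s ∧ x = m + s * -p} :=
    fun x hx => ⟨x, hx, 0, IsSumSq.zero, by ring⟩
  -- If $-1=m-sp$, then $sp-1=m\in M$. Otherwise the enlarged module is nonnegative at a real point,
  -- which lies in the set and has $p\le0$.
  by_cases hneg : -1 ∈ {x | ∃ m ∈ quadraticModule f, ∃ s, IsSumSq s ∧ x = m + s * -p}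
  · obtain ⟨m, hm, s, hs, h⟩ := hneg
    refine hq.mem_of_isSumSq_mul_sub_one_mem hb hs ?_
    convert hm using 1
    linear_combination h
  · exfalso
    have hb' : hq'.bounded = ⊤ := by
      rw [eq_top_iff, ← hb]
      rintro q ⟨N, h1, h2⟩
      exact ⟨N, hsub _ h1, hsub _ h2⟩
    obtain ⟨φ, hφ⟩ := hq'.exists_algHom hneg hb'
    have heval : ∀ q, φ q = MvPolynomial.eval (fun i => φ (MvPolynomial.X i)) q := fun q => by
      have : φ = MvPolynomial.aeval fun i => φ (MvPolynomial.X i) :=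
        MvPolynomial.algHom_ext fun i => by simp
      conv_lhs => rw [this]
      rw [MvPolynomial.aeval_eq_eval]
    have h1 := hp (fun i => φ (MvPolynomial.X i)) fun j => by
      rw [← heval]
      exact hφ _ (hsub _ (mem_quadraticModule f j))
    have h2 := hφ (-p) ⟨0, hq.zero, 1, IsSumSq.one, by ring⟩
    rw [map_neg, heval] at h2
    linarith

end Putinar

/-! ### Safety, monotonicity and convergence of the relaxations. -/

theorem IsSumSq.eval_nonneg {n : ℕ} {s : MvPolynomial (Fin n) ℝ} (hs : IsSumSq s)
    (x : Fin n → ℝ) : 0 ≤ MvPolynomial.eval x s := by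
  induction hs with
  | zero => simp
  | sq_add a _ ih =>
    rw [map_add, map_mul]
    exact add_nonneg (mul_self_nonneg _) ih

theorem MvPolynomial.eval_affine_combination {n : ℕ} {p : MvPolynomial (Fin n) ℝ}
    (hp : p.totalDegree ≤ 1) {a b : ℝ} (hab : a + b = 1) (x y : Fin n → ℝ) :
    MvPolynomial.eval (a • x + b • y) p
      = a * MvPolynomial.eval x p + b * MvPolynomial.eval y p := by
  rw [eval_eq', eval_eq', eval_eq', Finset.mul_sum, Finset.mul_sum, ← Finset.sum_add_distrib]
  refine Finset.sum_congr rfl fun d hd => ?_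
  have hd1 : d.degree ≤ 1 := (le_totalDegree hd).trans hp
  rcases Nat.le_one_iff_eq_zero_or_eq_one.1 hd1 with h | h
  · have : d = 0 := (Finsupp.degree_eq_zero_iff d).1 h
    subst this
    simp only [Finsupp.coe_zero, Pi.zero_apply, pow_zero, Finset.prod_const_one]
    linear_combination (-coeff 0 p) * hab
  · obtain ⟨i, rfl⟩ := (Finsupp.sum_eq_one_iff d).1 h
    have hprod : ∀ z : Fin n → ℝ, ∏ j, z j ^ (Finsupp.single i 1 : Fin n →₀ ℕ) j = z i := by
      intro z
      rw [Finset.prod_eq_single i (fun j _ hj => by simp [Finsupp.single_eq_of_ne hj]) (by simp)]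
      simp
    rw [hprod, hprod, hprod]
    simp only [Pi.add_apply, Pi.smul_apply, smul_eq_mul]
    ring

theorem translationPart_affine_combination (θ : ℝ) (ω v w : Fin 3 → ℝ) (a b : ℝ) :
    translationPart θ ω (a • v + b • w)
      = a • translationPart θ ω v + b • translationPart θ ω w := by
  simp only [translationPart, Matrix.mulVec_add, Matrix.mulVec_smul]
  module

namespace SafeControlProblem

variable {n a b m : ℕ} (D : SafeControlProblem n a b m)

theorem eval_movedRegion (u : Control) (i : Fin b) (x : Fin n → ℝ) :
    MvPolynomial.eval x (D.movedRegion u i) = MvPolynomial.eval (D.motion u x) (D.fB i) := by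
  rw [movedRegion, MvPolynomial.eval, MvPolynomial.eval₂Hom_bind₁]
  congr 2
  funext i'
  simp [motion]

/-- The rotation does not depend on $\hat v$ and the translation is linear in it; hence weights that
sum to one. -/
theorem motion_affine_combination (ω v w : Fin 3 → ℝ) {r s : ℝ} (hrs : r + s = 1)
    (x : Fin n → ℝ) :
    D.motion (ω, r • v + s • w) x = r • D.motion (ω, v) x + s • D.motion (ω, w) x := by
  funext i
  simp only [motion, translationPart_affine_combination, Pi.add_apply, Pi.smul_apply, smul_eq_mul]
  linear_combination
    (-∑ j, rotationPart D.θ ω (D.coord i) (D.coord j) * x j) * hrs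

variable {D}

theorem IsRelaxFeasible.isFeasible {k : ℕ} {u : Control} {σ₀ : Fin b → MvPolynomial (Fin n) ℝ}
    {σ : Fin b → Fin a → MvPolynomial (Fin n) ℝ} (h : D.IsRelaxFeasible k u σ₀ σ) :
    D.IsFeasible u := by
  refine ⟨fun i x hx => ?_, h.2.1⟩
  rw [h.1 i, map_add, map_sum]
  refine add_nonneg ((h.2.2.1 i).1.eval_nonneg x) (Finset.sum_nonneg fun j _ => ?_)
  rw [map_mul]
  exact mul_nonneg ((h.2.2.2 i j).1.eval_nonneg x) (hx j)

theorem IsFeasible.isSafe {u : Control} (h : D.IsFeasible u) : D.IsSafe u := by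
  rintro _ ⟨x, hx, rfl⟩ i
  rw [← eval_movedRegion]
  exact h.1 i x hx

theorem IsRelaxFeasible.mono {k l : ℕ} (hkl : k ≤ l) {u : Control}
    {σ₀ : Fin b → MvPolynomial (Fin n) ℝ} {σ : Fin b → Fin a → MvPolynomial (Fin n) ℝ}
    (h : D.IsRelaxFeasible k u σ₀ σ) : D.IsRelaxFeasible l u σ₀ σ :=
  ⟨h.1, h.2.1, fun i => ⟨(h.2.2.1 i).1, (h.2.2.1 i).2.trans (by omega)⟩,
    fun i j => ⟨(h.2.2.2 i j).1, (h.2.2.2 i j).2.trans (by omega)⟩⟩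

variable (D)

theorem optimalValue_le_relaxValue (k : ℕ) : D.optimalValue ≤ D.relaxValue k :=
  sInf_le_sInf fun _ ⟨u, _, _, h, hy⟩ => ⟨u, h.isFeasible, hy⟩

theorem antitone_relaxValue : Antitone D.relaxValue := fun _ _ hkl =>
  sInf_le_sInf fun _ ⟨u, σ₀, σ, h, hy⟩ => ⟨u, σ₀, σ, h.mono hkl, hy⟩

variable {D}

theorem IsOptimal.optimalValue_eq {u : Control} (h : D.IsOptimal u) :
    D.optimalValue = (evalControl D.cost u : EReal) := by
  refine le_antisymm (sInf_le ⟨u, h.1, rfl⟩) (le_sInf ?_)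
  rintro _ ⟨u', hu', rfl⟩
  exact EReal.coe_le_coe_iff.2 (h.2 u' hu')

/-- A control that keeps the robot strictly inside the free region is feasible for the relaxations
of large order. -/
theorem exists_isRelaxFeasible (hA : IsArchimedeanQmod D.fA) {u : Control}
    (hu : u ∈ D.feasibleSet)
    (hpos : ∀ x ∈ D.robot, ∀ i, 0 < MvPolynomial.eval x (D.movedRegion u i)) :
    ∃ k σ₀ σ, D.IsRelaxFeasible k u σ₀ σ := by
  have h : ∀ i, D.movedRegion u i ∈ quadraticModule D.fA := fun i =>
    mem_quadraticModule_of_pos hA fun x hx => hpos x hx i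
  choose σ₀ σ hσ₀ hσ hσeq using h
  -- Any order dominating all degrees in the certificates will do; their sum is such a bound.
  refine ⟨∑ i, (σ₀ i).totalDegree + ∑ i, ∑ j, ((σ i j).totalDegree + (D.fA j).totalDegree),
    σ₀, σ, hσeq, hu, fun i => ⟨hσ₀ i, ?_⟩, fun i j => ⟨hσ i j, ?_⟩⟩
  · have := Finset.single_le_sum (f := fun i => (σ₀ i).totalDegree) (fun _ _ => Nat.zero_le _)
      (Finset.mem_univ i)
    omega
  · have h1 := Finset.single_le_sum
      (f := fun i => ∑ j, ((σ i j).totalDegree + (D.fA j).totalDegree))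
      (fun _ _ => Nat.zero_le _) (Finset.mem_univ i)
    have h2 := Finset.single_le_sum (f := fun j => (σ i j).totalDegree + (D.fA j).totalDegree)
      (fun _ _ => Nat.zero_le _) (Finset.mem_univ j)
    omega

theorem continuous_evalControl_segment (p : MvPolynomial (Fin 3 ⊕ Fin 3) ℝ)
    (ω v w : Fin 3 → ℝ) :
    Continuous fun t : ℝ => evalControl p (ω, (1 - t) • v + t • w) := by
  refine (MvPolynomial.continuous_eval p).comp (continuous_pi ?_)
  rintro (i | i)
  · exact continuous_const
  · simp only [Sum.elim_inr, Pi.add_apply, Pi.smul_apply]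
    fun_prop

theorem tendsto_relaxValue (hB : ∀ i, (D.fB i).totalDegree ≤ 1)
    (hS : D.StrictInteriorAssumption)
    (hG : ∀ ω : Fin 3 → ℝ, Convex ℝ {v : Fin 3 → ℝ | (ω, v) ∈ D.feasibleSet})
    (hA : IsArchimedeanQmod D.fA) :
    Filter.Tendsto D.relaxValue Filter.atTop (nhds D.optimalValue) := by
  obtain ⟨ω, v, hopt, w, hw, hpos⟩ := hS
  refine tendsto_order.2 ⟨fun y hy => Filter.Eventually.of_forall fun k =>
    hy.trans_le (D.optimalValue_le_relaxValue k), fun y hy => ?_⟩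
  rw [hopt.optimalValue_eq] at hy
  have hcont : Continuous fun t : ℝ =>
      (evalControl D.cost (ω, (1 - t) • v + t • w) : EReal) :=
    continuous_coe_real_ereal.comp (continuous_evalControl_segment D.cost ω v w)
  have h0 : ∀ᶠ t in nhdsWithin (0 : ℝ) (Set.Ioi 0),
      (evalControl D.cost (ω, (1 - t) • v + t • w) : EReal) < y :=
    nhdsWithin_le_nhds (hcont.continuousAt.eventually (gt_mem_nhds (by simpa using hy)))
  -- Small $t$ keeps the cost below $y$; $t>0$ gives the strictly safe end positive weight.
  obtain ⟨t, ht, ht0, ht1⟩ := (h0.and (Ioo_mem_nhdsGT one_pos)).exists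
  have hu : (ω, (1 - t) • v + t • w) ∈ D.feasibleSet :=
    hG ω hopt.1.2 hw (by linarith) ht0.le (by ring)
  obtain ⟨k, σ₀, σ, hk⟩ := exists_isRelaxFeasible hA hu fun x hx i => by
    have h1 : 0 ≤ MvPolynomial.eval x (D.movedRegion (ω, v) i) := hopt.1.1 i x hx
    have h2 := hpos x hx i
    rw [eval_movedRegion] at h1 h2 ⊢
    rw [motion_affine_combination _ _ _ _ (by ring),
      MvPolynomial.eval_affine_combination (hB i) (by ring)]
    exact add_pos_of_nonneg_of_pos (mul_nonneg (by linarith) h1) (mul_pos ht0 h2)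
  filter_upwards [Filter.eventually_ge_atTop k] with l hl
  exact (sInf_le ⟨_, σ₀, σ, hk.mono hl, rfl⟩ : D.relaxValue l ≤ _).trans_lt ht

end SafeControlProblem

theorem theorem2 {n a b m : ℕ} (D : SafeControlProblem n a b m) :
    (∀ k, D.IsOrder k →
      (∀ u σ₀ σ, D.IsRelaxMinimizer k u σ₀ σ → D.IsSafe u) ∧
        D.optimalValue ≤ D.relaxValue k) ∧
    AntitoneOn D.relaxValue {k | D.IsOrder k} ∧
    ((∀ i, (D.fB i).totalDegree ≤ 1) →
      D.StrictInteriorAssumption →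
      (∀ ω : Fin 3 → ℝ, Convex ℝ {v : Fin 3 → ℝ | (ω, v) ∈ D.feasibleSet}) →
      IsArchimedeanQmod D.fA →
      Filter.Tendsto D.relaxValue Filter.atTop (nhds D.optimalValue)) :=
  ⟨fun k _ => ⟨fun _ _ _ h => h.1.isFeasible.isSafe, D.optimalValue_le_relaxValue k⟩,
    D.antitone_relaxValue.antitoneOn _,
    SafeControlProblem.tendsto_relaxValue⟩
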